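/- Notation. Let $n\ge 1$, $p,q\in\mathbb C$ with $|p|<1$, $q\neq0$. Put $(a;p)_\infty=\prod_{j\ge0}(1-ap^j)$, $\theta(a)=\theta(a;p)=(a;p)_\infty(p/a;p)_\infty$ for $a\ne 0$, and for $k\in\mathbb Z_{\ge0}$ put $(a)_k=(a;q,p)_k=\prod_{j=0}^{k-1}\theta(aq^j;p)$. For $n$-tuples $\mathbf k=(k_1,\dots,k_n)$ of non-negative integers write $|\mathbf k|=k_1+\dots+k_n$, and write $\mathbf j\le\mathbf k$ if $j_r\le k_r$ for all $r$. Let $x_1,\dots,x_n$ be non-zero complex numbers. For $\mathbf j\le\mathbf k$ the entries of the $A_n$ elliptic Bressoud matrix $\mathbf B^{(1)}$ are $$B^{(1)}_{\mathbf k\mathbf j}(a,b)=\frac{(b/a)_{|\mathbf k|-|\mathbf j|}}{\prod_{r,s=1}^n (q^{1+j_r-j_s}x_r/x_s)_{k_r-j_r}}\prod_{r=1}^n\frac{(bx_r)_{j_r+|\mathbf k|}}{(ax_rq)_{k_r+|\mathbf j|}} .$$ Sequences $\alpha=(\alpha_{\mathbf N}(a,b))$ and $\beta=(\beta_{\mathbf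 N}(a,b))$ of complex numbers, indexed by $n$-tuples $\mathbf N$ of non-negative integers and depending on parameters $a,b$, form a WP Bailey pair with respect to $\mathbf B^{(1)}$ (at the parameter values $a,b$) if $$\beta_{\mathbf N}(a,b)=\sum_{\mathbf 0\le\mathbf j\le\mathbf N}B^{(1)}_{\mathbf N\mathbf j}(a,b)\,\alpha_{\mathbf j}(a,b)\qquad\text{for all }\mathbf N .$$ Theorem (elliptic $\mathbf B^{(1)}\to\mathbf B^{(1)}$ WP Bailey lemma). Let $a,b,\rho_1,\rho_2$ be non-zero complex numbers such that none of the denominators in the formulas above and below vanishes; that is, for all integers $k\ge0$, all indices $r,s$ and all $\mathbf j$, the numbers $(q^{1+j_r-j_s}x_r/x_s)_k$, $(ax_rq)_k$, $(ax_rq/\rho_1)_k$, $(aq/\rho_2)_k$, $(b\rho_1/a)_k$, $(b\rho_2x_r/a)_k$, $\theta(b\rho_1\rho_2x_r/aq)$ and $(b\rho_1\rho_2x_r/a)_k$ are non-zero. Suppose that $\alpha$ and $\beta$ form a WP Bailey pair with respect to $\mathbf B^{(1)}$ at the parameter values $a,\ b\rho_1\rho_2/aq$ (in particular, this holds if they form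 one for all values of the parameters). Define $$\alpha'_{\mathbf N}(a,b)=\frac{(\rho_1)_{|\mathbf N|}}{(aq/\rho_2)_{|\mathbf N|}}\prod_{r=1}^n\frac{(\rho_2x_r)_{N_r}}{(ax_rq/\rho_1)_{N_r}}\cdot\Big(\frac{aq}{\rho_1\rho_2}\Big)^{|\mathbf N|}\alpha_{\mathbf N}(a,b\rho_1\rho_2/aq),$$ $$\beta'_{\mathbf N}(a,b)=\frac{(b\rho_1/a)_{|\mathbf N|}}{(aq/\rho_2)_{|\mathbf N|}}\prod_{r=1}^n\frac{(b\rho_2x_r/a)_{N_r}}{(ax_rq/\rho_1)_{N_r}}\sum_{\mathbf 0\le\mathbf k\le\mathbf N}\Bigg(\frac{(\rho_1)_{|\mathbf k|}}{(b\rho_1/a)_{|\mathbf k|}}\prod_{r=1}^n\frac{(\rho_2x_r)_{k_r}}{(b\rho_2x_r/a)_{k_r}}\prod_{r=1}^n\left(\frac{\theta(b\rho_1\rho_2x_rq^{k_r+|\mathbf k|}/aq)}{\theta(b\rho_1\rho_2x_r/aq)}\cdot\frac{(bx_r)_{k_r+|\mathbf N|}}{(b\rho_1\rho_2x_r/a)_{|\mathbf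 k|+N_r}}\right)$$ $$\qquad\times\frac{(aq/\rho_1\rho_2)_{|\mathbf N|-|\mathbf k|}}{\prod_{r,s=1}^n(q^{1+k_r-k_s}x_r/x_s)_{N_r-k_r}}\Big(\frac{aq}{\rho_1\rho_2}\Big)^{|\mathbf k|}\beta_{\mathbf k}(a,b\rho_1\rho_2/aq)\Bigg).$$ Then $\alpha'$ and $\beta'$ form a WP Bailey pair with respect to $\mathbf B^{(1)}$ at the parameter values $a,b$. -/

import Mathlib

noncomputable section

namespace EllipticWPBailey

/-- The infinite shifted factorial `(a; p)_∞ = ∏_{j ≥ 0} (1 - a p^j)`, for `|p| < 1`. -/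
def infFactorial (a p : ℂ) : ℂ := ∏' j : ℕ, (1 - a * p ^ j)

/-- The modified Jacobi theta function `θ(a; p) = (a; p)_∞ (p/a; p)_∞`, for `a ≠ 0`, `|p| < 1`. -/
def theta (p a : ℂ) : ℂ := infFactorial a p * infFactorial (p / a) p

/-- The theta shifted factorial `(a; q, p)_k = ∏_{j=0}^{k-1} θ(a q^j; p)` for an arbitrary integer
`k`; for `k = -(m+1) < 0` the product is understood as
`(θ(a q^{-1}; p) θ(a q^{-2}; p) ⋯ θ(a q^{-(m+1)}; p))⁻¹`. -/
def qpFactorial (p q a : ℂ) : ℤ → ℂ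
  | Int.ofNat m => ∏ j ∈ Finset.range m, theta p (a * q ^ j)
  | Int.negSucc m => (∏ j ∈ Finset.range (m + 1), theta p (a * q ^ (-((j : ℤ) + 1))))⁻¹

/-- The sum of the components `|k| = k_1 + ⋯ + k_n`, as an integer. -/
def size {n : ℕ} (k : Fin n → ℕ) : ℤ := ∑ r, (k r : ℤ)

/-- The `A_n` elliptic Bressoud matrix `B⁽¹⁾(a, b)`, with rows and columns indexed by `n`-tuples of
non-negative integers. -/
def bressoudB1 {n : ℕ} (p q : ℂ) (x : Fin n → ℂ) (a b : ℂ) :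
    Matrix (Fin n → ℕ) (Fin n → ℕ) ℂ := fun k j =>
  qpFactorial p q (b / a) (size k - size j) /
      (∏ r, ∏ s, qpFactorial p q (q ^ (1 + (j r : ℤ) - (j s : ℤ)) * (x r / x s))
        ((k r : ℤ) - (j r : ℤ))) *
    ∏ r, qpFactorial p q (b * x r) ((j r : ℤ) + size k) /
      qpFactorial p q (a * x r * q) ((k r : ℤ) + size j)

/-- The sequences `α(a, b)`, `β(a, b)`, indexed by `n`-tuples of non-negative integers, form a WP
Bailey pair with respect to the matrix `B`, at the parameter values `a`, `b`:
`β_N(a, b) = ∑_{0 ≤ j_r ≤ N_r} B_{N j}(a, b) α_j(a, b)` for all `N`. -/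
def IsWPBaileyPair {n : ℕ} (B : ℂ → ℂ → Matrix (Fin n → ℕ) (Fin n → ℕ) ℂ)
    (α β : ℂ → ℂ → (Fin n → ℕ) → ℂ) (a b : ℂ) : Prop :=
  ∀ N : Fin n → ℕ, β a b N = ∑ j ∈ Finset.Icc 0 N, B a b N j * α a b j

/-- The sequence `α'(a, b)`. -/
def alphaPrime {n : ℕ} (p q : ℂ) (x : Fin n → ℂ) (ρ₁ ρ₂ : ℂ) (α : ℂ → ℂ → (Fin n → ℕ) → ℂ) :
    ℂ → ℂ → (Fin n → ℕ) → ℂ := fun a b N =>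
  qpFactorial p q ρ₁ (size N) / qpFactorial p q (a * q / ρ₂) (size N) *
    (∏ r, qpFactorial p q (ρ₂ * x r) (N r) / qpFactorial p q (a * x r * q / ρ₁) (N r)) *
    (a * q / (ρ₁ * ρ₂)) ^ size N *
    α a (b * ρ₁ * ρ₂ / (a * q)) N

/-- The sequence `β'(a, b)`. -/
def betaPrime {n : ℕ} (p q : ℂ) (x : Fin n → ℂ) (ρ₁ ρ₂ : ℂ) (β : ℂ → ℂ → (Fin n → ℕ) → ℂ) :
    ℂ → ℂ → (Fin n → ℕ) → ℂ := fun a b N =>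
  qpFactorial p q (b * ρ₁ / a) (size N) / qpFactorial p q (a * q / ρ₂) (size N) *
    (∏ r, qpFactorial p q (b * ρ₂ * x r / a) (N r) /
      qpFactorial p q (a * x r * q / ρ₁) (N r)) *
    ∑ k ∈ Finset.Icc 0 N,
      qpFactorial p q ρ₁ (size k) / qpFactorial p q (b * ρ₁ / a) (size k) *
      (∏ r, qpFactorial p q (ρ₂ * x r) (k r) / qpFactorial p q (b * ρ₂ * x r / a) (k r)) *
      (∏ r, theta p (b * ρ₁ * ρ₂ * x r * q ^ ((k r : ℤ) + size k) / (a * q)) /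
          theta p (b * ρ₁ * ρ₂ * x r / (a * q)) *
        (qpFactorial p q (b * x r) ((k r : ℤ) + size N) /
          qpFactorial p q (b * ρ₁ * ρ₂ * x r / a) (size k + (N r : ℤ)))) *
      (qpFactorial p q (a * q / (ρ₁ * ρ₂)) (size N - size k) /
        ∏ r, ∏ s, qpFactorial p q (q ^ (1 + (k r : ℤ) - (k s : ℤ)) * (x r / x s))
          ((N r : ℤ) - (k r : ℤ))) *
      (a * q / (ρ₁ * ρ₂)) ^ size k *
      β a (b * ρ₁ * ρ₂ / (a * q)) k

end EllipticWPBailey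

end

open Filter Topology Finset

noncomputable section

namespace EllipticWPBailey

/-! Put λ = bρ₁ρ₂/(aq). Inserting the given pair at (a, λ) into β' and interchanging the sums over 0
≤ j ≤ k ≤ N reduces the claim, one coefficient α_j at a time, to ∑_{j ≤ k ≤ N} K_{Nk} B_{kj}(a, λ) =
B_{Nj}(a, b) w_j, where K and w are the coefficients of β_k in β' and of α_j in α'
(`sum_betaKernel_mul_bressoudB1`). For fixed j and N this is an A_n elliptic Jackson summation over
a rectangle (`sum_Icc_theta`).

That summation specialises an identity in free variables, a sum over all subsets S of a finite set T
(`IsSigma.sum_jacksonTerm`). When the variables are the points x_r q^i with j_r ≤ i < N_r, a subset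
with a gap below one of its points contributes a factor θ(1) = 0, and only unions of initial
segments, that is, tuples k, survive.

The subset identity goes by induction on T. In the newest variable y, the difference of the two
sides, cleared of denominators, is a combination of products of 2#T + 2 theta functions whose zeros
have a common sum. Such a function vanishes once it has 2#T + 2 distinct zeros with a different sum
(`IsSigma.eq_zero_of_mem_thetaSpace`). These zeros are the old variables and the points -(g + ih),
where terms cancel in pairs, and -d, where the induction hypothesis applies. Exceptional parameters
are reached by continuity, since they form countable sets.

The vanishing principle is an interpolation formula, hence a partial fraction identity
(`IsSigma.sum_prod_div_prod_eq_zero`), which follows from the Weierstrass three-term relation. The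
latter is a Plücker relation: by the Jacobi triple product, θ(xy)θ(x/y) is, up to a factor, a 2×2
determinant in x and y (`exists_theta_mul_theta`). -/

/-! ### The Jacobi triple product -/

/-- The finite product `(p; p)_m`. -/
def finEuler (p : ℂ) (m : ℕ) : ℂ := ∏ i ∈ range m, (1 - p ^ (i + 1))

/-- The `p`-binomial coefficients. -/
def gaussBinom (p : ℂ) (N j : ℕ) : ℂ :=
  if j ≤ N then finEuler p N / (finEuler p j * finEuler p (N - j)) else 0

lemma one_sub_pow_succ_ne_zero {p : ℂ} (hp : ‖p‖ < 1) (i : ℕ) : 1 - p ^ (i + 1) ≠ 0 := by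
  intro h
  have h1 : ‖p ^ (i + 1)‖ = 1 := by rw [← sub_eq_zero.mp h]; simp
  rw [norm_pow] at h1
  have := pow_lt_one₀ (norm_nonneg p) hp (Nat.succ_ne_zero i)
  exact absurd h1 this.ne

lemma finEuler_ne_zero {p : ℂ} (hp : ‖p‖ < 1) (m : ℕ) : finEuler p m ≠ 0 :=
  prod_ne_zero_iff.mpr fun i _ => one_sub_pow_succ_ne_zero hp i

lemma finEuler_succ (p : ℂ) (m : ℕ) : finEuler p (m + 1) = finEuler p m * (1 - p ^ (m + 1)) :=
  prod_range_succ _ _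

lemma gaussBinom_zero_right {p : ℂ} (hp : ‖p‖ < 1) (N : ℕ) : gaussBinom p N 0 = 1 := by
  have := finEuler_ne_zero hp N
  have h0 : finEuler p 0 = 1 := by simp [finEuler]
  simp [gaussBinom, h0, this]

lemma gaussBinom_succ_succ {p : ℂ} (hp : ‖p‖ < 1) {N j : ℕ} (hj : j ≤ N) :
    gaussBinom p (N + 1) (j + 1) = gaussBinom p N (j + 1) + p ^ (N - j) * gaussBinom p N j := by
  obtain ⟨m, rfl⟩ := Nat.exists_eq_add_of_le hj
  have h1 := finEuler_ne_zero hp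
  have h2 := one_sub_pow_succ_ne_zero hp
  -- For j = N the coefficient `gaussBinom p N (N + 1)` is zero by convention, not a quotient, so
  -- this case is separate.
  rcases m with _ | m
  · have h0 : finEuler p 0 = 1 := by simp [finEuler]
    simp [gaussBinom, h0, h1]
  · have e1 : j + (m + 1) + 1 - (j + 1) = m + 1 := by omega
    have e2 : j + (m + 1) - (j + 1) = m := by omega
    have e3 : j + (m + 1) - j = m + 1 := by omega
    rw [gaussBinom, gaussBinom, gaussBinom, if_pos (by omega), if_pos (by omega),
      if_pos (by omega), e1, e2, e3, finEuler_succ p (j + (m + 1)), finEuler_succ p j,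
      finEuler_succ p m]
    have := h1 j
    have := h1 m
    have := h1 (j + (m + 1))
    have := h2 j
    have := h2 m
    field_simp
    ring

/-- The `p`-binomial theorem. -/
lemma prod_one_sub_mul_pow {p : ℂ} (hp : ‖p‖ < 1) (z : ℂ) (N : ℕ) :
    ∏ i ∈ range N, (1 - z * p ^ i) =
      ∑ j ∈ range (N + 1), (-1) ^ j * p ^ (j.choose 2) * z ^ j * gaussBinom p N j := by
  induction N with
  | zero => simp [gaussBinom_zero_right hp]
  | succ N ih =>
    rw [prod_range_succ, ih, sum_range_succ' _ (N + 1), gaussBinom_zero_right hp]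
    have h1 : ∑ j ∈ range (N + 1), (-1) ^ (j + 1) * p ^ ((j + 1).choose 2) * z ^ (j + 1) *
        gaussBinom p (N + 1) (j + 1) =
        ∑ j ∈ range (N + 1), (-1) ^ (j + 1) * p ^ ((j + 1).choose 2) * z ^ (j + 1) *
          gaussBinom p N (j + 1) +
        (- (z * p ^ N)) * ∑ j ∈ range (N + 1), (-1) ^ j * p ^ (j.choose 2) * z ^ j *
          gaussBinom p N j := by
      rw [mul_sum, ← sum_add_distrib]
      refine sum_congr rfl fun j hj => ?_
      have hj' : j ≤ N := by simpa [Nat.lt_succ_iff] using hj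
      rw [gaussBinom_succ_succ hp hj', Nat.choose_succ_succ' j 1, Nat.choose_one_right]
      have : p ^ N = p ^ j * p ^ (N - j) := by rw [← pow_add]; congr 1; omega
      rw [this]
      ring
    have h2 : ∑ j ∈ range (N + 1), (-1) ^ (j + 1) * p ^ ((j + 1).choose 2) * z ^ (j + 1) *
          gaussBinom p N (j + 1) + 1 =
        ∑ j ∈ range (N + 1), (-1) ^ j * p ^ (j.choose 2) * z ^ j * gaussBinom p N j := by
      have := sum_range_succ' (fun j => (-1) ^ j * p ^ (j.choose 2) * z ^ j * gaussBinom p N j)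
        (N + 1)
      rw [sum_range_succ] at this
      have h0 : gaussBinom p N (N + 1) = 0 := by simp [gaussBinom]
      rw [h0, mul_zero, add_zero, gaussBinom_zero_right hp] at this
      rw [this]
      simp
    rw [h1, Nat.choose_zero_succ, pow_zero, pow_zero, pow_zero]
    linear_combination -h2

/-- The triangular exponent `k (k - 1) / 2` for integral `k`. -/
def triExp (k : ℤ) : ℤ := k * (k - 1) / 2

lemma two_mul_triExp (k : ℤ) : 2 * triExp k = k * (k - 1) := by
  have : Even (k * (k - 1)) := Int.even_mul_pred_self k
  rw [triExp]
  exact Int.mul_ediv_cancel' this.two_dvd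

/-- The terms of the Jacobi theta series. -/
def thetaTerm (p z : ℂ) (k : ℤ) : ℂ := (-1) ^ k * p ^ triExp k * z ^ k

/-- Finite form of the triple product: the p-binomial theorem of length 2n at z p^(-n). The first n
factors, reflected, give ∏ (1 - p^(i+1)/z) up to the monomial computed in `h2`. -/
lemma prod_mul_prod_eq_sum {p : ℂ} (hp : ‖p‖ < 1) (hp0 : p ≠ 0) {z : ℂ} (hz : z ≠ 0) (n : ℕ) :
    (∏ i ∈ range n, (1 - z * p ^ i)) * ∏ i ∈ range n, (1 - p / z * p ^ i) =
      ∑ k ∈ Icc (-n : ℤ) n, thetaTerm p z k * gaussBinom p (2 * n) (n + k).toNat := by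
  have h1 : ∏ i ∈ range (2 * n), (1 - z * p ^ (-(n : ℤ)) * p ^ i) =
      (∏ i ∈ range n, (-z * p ^ (-((i : ℤ) + 1)))) * ((∏ i ∈ range n, (1 - z * p ^ i)) *
        ∏ i ∈ range n, (1 - p / z * p ^ i)) := by
    rw [two_mul, prod_range_add,
      mul_left_comm (∏ i ∈ range n, (-z * p ^ (-((i : ℤ) + 1)))),
      mul_comm (∏ i ∈ range n, (1 - z * p ^ (-(n : ℤ)) * p ^ i))]
    refine congrArg₂ _ ?_ ?_
    · refine prod_congr rfl fun i _ => ?_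
      rw [pow_add, zpow_neg, zpow_natCast]
      field_simp
    · rw [← prod_mul_distrib, ← prod_range_reflect]
      refine prod_congr rfl fun i hi => ?_
      have hi' : i < n := by simpa using hi
      have : p ^ (n - 1 - i) = p ^ (n : ℤ) * p ^ (-((i : ℤ) + 1)) := by
        rw [← zpow_natCast, ← zpow_add₀ hp0]
        congr 1
        omega
      rw [this, zpow_neg, zpow_neg, zpow_natCast, zpow_add₀ hp0, zpow_natCast, zpow_one]
      field_simp
      ring
  have h2 : ∏ i ∈ range n, (-z * p ^ (-((i : ℤ) + 1))) =
      ((-1) ^ (n : ℤ) * z ^ (n : ℤ) * p ^ (- triExp (n + 1))) := by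
    clear h1
    induction n with
    | zero => simp [triExp]
    | succ n ih =>
      have e : triExp ((n : ℤ) + 1 + 1) = triExp (n + 1) + (n + 1) := by
        have a1 := two_mul_triExp ((n : ℤ) + 1 + 1)
        have a2 := two_mul_triExp ((n : ℤ) + 1)
        linarith
      rw [prod_range_succ, ih]
      push_cast
      rw [e, neg_add (triExp _), zpow_add₀ hp0 (-triExp _), zpow_add₀ hz, zpow_add₀ (by norm_num : (-1 : ℂ) ≠ 0)]
      simp only [zpow_one]
      generalize p ^ (-((n : ℤ) + 1)) = w
      ring
  have h3 : ∏ i ∈ range n, (-z * p ^ (-((i : ℤ) + 1))) ≠ 0 := by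
    rw [h2]
    have : (-1 : ℂ) ^ (n : ℤ) ≠ 0 := zpow_ne_zero _ (by norm_num)
    have := zpow_ne_zero (n : ℤ) hz
    have := zpow_ne_zero (- triExp (n + 1)) hp0
    simp_all
  apply mul_left_cancel₀ h3
  rw [← h1, prod_one_sub_mul_pow hp, mul_sum]
  refine sum_nbij' (fun j => (j : ℤ) - n) (fun k => (n + k).toNat) ?_ ?_ ?_ ?_ ?_
  · intro j hj
    simp only [mem_range, mem_Icc] at *
    omega
  · intro j hj
    simp only [mem_range, mem_Icc] at *
    omega
  · intro j hj
    simp only [mem_range] at *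
    omega
  · intro j hj
    simp only [mem_Icc] at *
    omega
  · intro j hj
    have e1 : ((n : ℤ) + (j - n)).toNat = j := by omega
    rw [e1, h2, thetaTerm, mul_pow, ← mul_assoc (_ * _ : ℂ) _ (gaussBinom _ _ _)]
    congr 1
    have e2 : ((j.choose 2 : ℕ) : ℤ) = triExp j := by
      rw [Nat.choose_two_right, triExp]
      rcases j with _ | j
      · simp
      · push_cast; simp
    have e3 : (-1 : ℂ) ^ j = (-1) ^ (n : ℤ) * (-1) ^ ((j : ℤ) - n) := by
      rw [← zpow_add₀ (by norm_num), ← zpow_natCast]; congr 1; ring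
    have e4 : z ^ j = z ^ (n : ℤ) * z ^ ((j : ℤ) - n) := by
      rw [← zpow_add₀ hz, ← zpow_natCast]; congr 1; ring
    have e5 : p ^ (j.choose 2) * (p ^ (-(n : ℤ))) ^ j =
        p ^ (- triExp (n + 1)) * p ^ triExp ((j : ℤ) - n) := by
      rw [← zpow_natCast p, e2, ← zpow_natCast (p ^ (-(n : ℤ))), ← zpow_mul, ← zpow_add₀ hp0,
        ← zpow_add₀ hp0]
      congr 1
      have a1 := two_mul_triExp ((n : ℤ) + 1)
      have a2 := two_mul_triExp ((j : ℤ) - n)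
      have a3 := two_mul_triExp (j : ℤ)
      have : (2 : ℤ) * (triExp j + -n * j) = 2 * (-triExp (n + 1) + triExp (j - n)) := by
        linear_combination a3 + a1 - a2
      linarith
    calc _ = (-1 : ℂ) ^ j * z ^ j * (p ^ (j.choose 2) * (p ^ (-(n : ℤ))) ^ j) := by ring
      _ = _ := by rw [e3, e4, e5]; ring

lemma summable_mul_pow_norm {p : ℂ} (hp : ‖p‖ < 1) (a : ℂ) : Summable fun j : ℕ => ‖-(a * p ^ j)‖ := by
  simp only [norm_neg, norm_mul, norm_pow]
  exact (summable_geometric_of_lt_one (norm_nonneg p) hp).mul_left _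

lemma multipliable_infFactorial {p : ℂ} (hp : ‖p‖ < 1) (a : ℂ) :
    Multipliable fun j : ℕ => 1 - a * p ^ j := by
  simpa [sub_eq_add_neg] using multipliable_one_add_of_summable (summable_mul_pow_norm hp a)

lemma tendsto_prod_infFactorial {p : ℂ} (hp : ‖p‖ < 1) (a : ℂ) :
    Tendsto (fun n => ∏ i ∈ range n, (1 - a * p ^ i)) atTop (𝓝 (infFactorial a p)) :=
  (multipliable_infFactorial hp a).hasProd.tendsto_prod_nat

lemma infFactorial_ne_zero {p : ℂ} (hp : ‖p‖ < 1) {a : ℂ} (h : ∀ j : ℕ, a * p ^ j ≠ 1) :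
    infFactorial a p ≠ 0 := by
  have := tprod_one_add_ne_zero_of_summable (f := fun j : ℕ => -(a * p ^ j))
    (fun j hj => h j (by linear_combination -hj)) (summable_mul_pow_norm hp a)
  simpa [infFactorial, sub_eq_add_neg] using this

lemma infFactorial_eq_mul {p : ℂ} (hp : ‖p‖ < 1) (a : ℂ) :
    infFactorial a p = (1 - a) * infFactorial (p * a) p := by
  have h := multipliable_infFactorial hp (p * a)
  have e : (fun j : ℕ => 1 - p * a * p ^ j) = fun j => 1 - a * p ^ (j + 1) := by
    ext j; ring
  rw [infFactorial, tprod_eq_zero_mul' (by simpa [e] using h), infFactorial, e]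
  simp

lemma theta_inv {p : ℂ} (hp : ‖p‖ < 1) {z : ℂ} (hz : z ≠ 0) :
    theta p z⁻¹ = -z⁻¹ * theta p z := by
  have h1 : p / z⁻¹ = p * z := by field_simp
  rw [theta, theta, infFactorial_eq_mul hp z⁻¹, infFactorial_eq_mul hp z, h1, ← div_eq_mul_inv p z]
  field_simp
  ring

lemma tendsto_finEuler {p : ℂ} (hp : ‖p‖ < 1) :
    Tendsto (finEuler p) atTop (𝓝 (infFactorial p p)) := by
  refine (tendsto_prod_infFactorial hp p).congr fun n => ?_
  exact prod_congr rfl fun i _ => by ring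

lemma infFactorial_self_ne_zero {p : ℂ} (hp : ‖p‖ < 1) : infFactorial p p ≠ 0 :=
  infFactorial_ne_zero hp fun j hj => one_sub_pow_succ_ne_zero hp j (by linear_combination -hj)

/-- Both (p; p)_m and its inverse converge, hence are bounded. The uniform bound supplies the
dominating series for the limit of `prod_mul_prod_eq_sum`. -/
lemma exists_norm_gaussBinom_le {p : ℂ} (hp : ‖p‖ < 1) :
    ∃ K : ℝ, 0 ≤ K ∧ ∀ N j, ‖gaussBinom p N j‖ ≤ K := by
  have h1 := (tendsto_finEuler hp).norm.bddAbove_range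
  have h2 := ((tendsto_finEuler hp).inv₀ (infFactorial_self_ne_zero hp)).norm.bddAbove_range
  obtain ⟨A, hA⟩ := h1
  obtain ⟨B, hB⟩ := h2
  have hA' : ∀ n, ‖finEuler p n‖ ≤ A := fun n => hA ⟨n, rfl⟩
  have hB' : ∀ n, ‖(finEuler p n)⁻¹‖ ≤ B := fun n => hB ⟨n, rfl⟩
  have hA0 := (norm_nonneg _).trans (hA' 0)
  have hB0 := (norm_nonneg _).trans (hB' 0)
  refine ⟨A * (B * B), by positivity, fun N j => ?_⟩
  rw [gaussBinom]
  split_ifs with h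
  · rw [div_eq_mul_inv, mul_inv, norm_mul, norm_mul]
    gcongr
    exacts [hA' _, hB' _, hB' _]
  · simp only [norm_zero]; positivity

lemma tendsto_gaussBinom {p : ℂ} (hp : ‖p‖ < 1) (k : ℤ) :
    Tendsto (fun n : ℕ => gaussBinom p (2 * n) (n + k).toNat) atTop (𝓝 (infFactorial p p)⁻¹) := by
  have hL := infFactorial_self_ne_zero hp
  have h := tendsto_finEuler hp
  have t1 : Tendsto (fun n : ℕ => 2 * n) atTop atTop :=
    tendsto_atTop_mono (f := fun n => n) (fun n => by omega) tendsto_id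
  have t2 : Tendsto (fun n : ℕ => ((n : ℤ) + k).toNat) atTop atTop :=
    tendsto_atTop_mono (f := fun n => n - k.natAbs) (fun n => by omega) (tendsto_sub_atTop_nat _)
  have t3 : Tendsto (fun n : ℕ => 2 * n - ((n : ℤ) + k).toNat) atTop atTop :=
    tendsto_atTop_mono (f := fun n => n - k.natAbs) (fun n => by omega) (tendsto_sub_atTop_nat _)
  have := (h.comp t1).div ((h.comp t2).mul (h.comp t3)) (mul_ne_zero hL hL)
  have e : infFactorial p p / (infFactorial p p * infFactorial p p) = (infFactorial p p)⁻¹ := by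
    field_simp
  rw [e] at this
  refine this.congr' ?_
  filter_upwards [eventually_ge_atTop k.natAbs] with n hn
  rw [gaussBinom, if_pos (by omega)]
  rfl

lemma summable_pow_choose_mul_pow {r : ℝ} (hr0 : 0 < r) (hr : r < 1) {t : ℝ} (ht : 0 < t) :
    Summable fun n : ℕ => r ^ (n.choose 2) * t ^ n := by
  refine summable_of_ratio_test_tendsto_lt_one (l := 0) one_pos
    (Eventually.of_forall fun n => by positivity) ?_
  have : Tendsto (fun n : ℕ => r ^ n * t) atTop (𝓝 (0 * t)) :=
    (tendsto_pow_atTop_nhds_zero_of_lt_one hr0.le hr).mul_const t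
  rw [zero_mul] at this
  refine this.congr fun n => ?_
  rw [Nat.choose_succ_succ' n 1, Nat.choose_one_right, pow_add, pow_succ,
    Real.norm_of_nonneg (by positivity), Real.norm_of_nonneg (by positivity)]
  field_simp

lemma triExp_natCast (n : ℕ) : triExp n = n.choose 2 := by
  rw [Nat.choose_two_right, triExp]
  rcases n with _ | n
  · simp
  · push_cast; simp

lemma triExp_neg_natCast (n : ℕ) : triExp (-n) = n.choose 2 + n := by
  have h1 := two_mul_triExp (-n)
  have h2 := two_mul_triExp n
  rw [← triExp_natCast]
  linarith

lemma summable_norm_thetaTerm {p : ℂ} (hp : ‖p‖ < 1) (hp0 : p ≠ 0) {z : ℂ} (hz : z ≠ 0) :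
    Summable fun k : ℤ => ‖thetaTerm p z k‖ := by
  have hp1 : 0 < ‖p‖ := norm_pos_iff.mpr hp0
  have hz1 : 0 < ‖z‖ := norm_pos_iff.mpr hz
  refine Summable.of_nat_of_neg ?_ ?_
  · refine (summable_pow_choose_mul_pow hp1 hp hz1).congr fun n => ?_
    rw [thetaTerm, triExp_natCast]
    simp
  · refine (summable_pow_choose_mul_pow hp1 hp (t := ‖p‖ / ‖z‖) (by positivity)).congr fun n => ?_
    rw [thetaTerm, triExp_neg_natCast, zpow_add₀ hp0]
    simp only [zpow_neg, zpow_natCast, norm_mul, norm_pow, norm_neg, norm_one, one_pow, norm_inv,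
      one_mul, inv_one, div_eq_mul_inv]
    ring

/-- The **Jacobi triple product identity**. -/
lemma infFactorial_mul_theta {p : ℂ} (hp : ‖p‖ < 1) (hp0 : p ≠ 0) {z : ℂ} (hz : z ≠ 0) :
    infFactorial p p * theta p z = ∑' k : ℤ, thetaTerm p z k := by
  obtain ⟨K, hK0, hK⟩ := exists_norm_gaussBinom_le hp
  have h1 : Tendsto (fun n : ℕ => ∑ k ∈ Icc (-n : ℤ) n,
      thetaTerm p z k * gaussBinom p (2 * n) (n + k).toNat) atTop (𝓝 (theta p z)) :=
    ((tendsto_prod_infFactorial hp z).mul (tendsto_prod_infFactorial hp (p / z))).congr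
      fun n => prod_mul_prod_eq_sum hp hp0 hz n
  -- The finite sums are padded with zeros to sums over ℤ, so that dominated convergence applies.
  have h2 : Tendsto (fun n : ℕ => ∑' k : ℤ, if k ∈ Icc (-n : ℤ) n then
      thetaTerm p z k * gaussBinom p (2 * n) (n + k).toNat else 0) atTop
      (𝓝 (∑' k : ℤ, thetaTerm p z k * (infFactorial p p)⁻¹)) := by
    refine tendsto_tsum_of_dominated_convergence (bound := fun k => ‖thetaTerm p z k‖ * K)
      ((summable_norm_thetaTerm hp hp0 hz).mul_right K) (fun k => ?_)
      (Eventually.of_forall fun n k => ?_)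
    · refine ((tendsto_gaussBinom hp k).const_mul (thetaTerm p z k)).congr' ?_
      filter_upwards [eventually_ge_atTop k.natAbs] with n hn
      rw [if_pos]
      rw [mem_Icc]
      omega
    · split_ifs
      · rw [norm_mul]
        gcongr
        exact hK _ _
      · simp only [norm_zero]; positivity
  have h3 : ∀ n : ℕ, (∑' k : ℤ, if k ∈ Icc (-n : ℤ) n then
      thetaTerm p z k * gaussBinom p (2 * n) (n + k).toNat else 0) = ∑ k ∈ Icc (-n : ℤ) n,
      thetaTerm p z k * gaussBinom p (2 * n) (n + k).toNat := fun n => by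
    rw [tsum_eq_sum (s := Icc (-n : ℤ) n) fun k hk => if_neg hk]
    exact sum_congr rfl fun k hk => if_pos hk
  simp only [h3] at h2
  rw [tendsto_nhds_unique h1 h2, tsum_mul_right]
  have := infFactorial_self_ne_zero hp
  field_simp

/-! ### Theta products as a form of rank two -/

/-- Splitting pairs of integers by the parity of their sum. -/
def parityEquiv : (ℤ × ℤ) ⊕ (ℤ × ℤ) ≃ ℤ × ℤ :=
  Equiv.ofBijective
    (Sum.elim (fun t => (t.1 + t.2, t.1 - t.2)) fun t => (t.1 + t.2 + 1, t.1 - t.2)) (by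
      constructor
      · rintro (⟨a, b⟩ | ⟨a, b⟩) (⟨c, d⟩ | ⟨c, d⟩) h <;>
          simp only [Sum.elim_inl, Sum.elim_inr, Prod.mk.injEq] at h <;>
          simp only [Sum.inl.injEq, Sum.inr.injEq, Prod.mk.injEq, reduceCtorEq] <;> omega
      · rintro ⟨m, n⟩
        rcases Int.emod_two_eq_zero_or_one (m + n) with h | h
        · exact ⟨Sum.inl ((m + n) / 2, (m - n) / 2), by simp; omega⟩
        · exact ⟨Sum.inr ((m + n - 1) / 2, (m - n - 1) / 2), by simp; omega⟩)

/-- Up to sign these are the terms of the theta series with base p² at x²; in the primed variant, at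
p x². -/
lemma summable_norm_zpow_sq {p : ℂ} (hp : ‖p‖ < 1) (hp0 : p ≠ 0) {x : ℂ} (hx : x ≠ 0) :
    Summable fun t : ℤ => ‖p ^ (t ^ 2 - t) * x ^ (2 * t)‖ := by
  have hp2 : ‖p ^ 2‖ < 1 := by
    rw [norm_pow]; exact pow_lt_one₀ (norm_nonneg p) hp two_ne_zero
  refine (summable_norm_thetaTerm hp2 (pow_ne_zero 2 hp0) (pow_ne_zero 2 hx)).congr fun t => ?_
  have e : t ^ 2 - t = 2 * triExp t := by rw [two_mul_triExp]; ring
  rw [thetaTerm, e, zpow_mul, zpow_mul, mul_assoc, norm_mul, norm_zpow, norm_neg, norm_one,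
    one_zpow, one_mul]
  rfl

lemma summable_norm_zpow_sq' {p : ℂ} (hp : ‖p‖ < 1) (hp0 : p ≠ 0) {x : ℂ} (hx : x ≠ 0) :
    Summable fun t : ℤ => ‖p ^ (t ^ 2) * x ^ (2 * t)‖ := by
  have hp2 : ‖p ^ 2‖ < 1 := by
    rw [norm_pow]; exact pow_lt_one₀ (norm_nonneg p) hp two_ne_zero
  refine (summable_norm_thetaTerm hp2 (pow_ne_zero 2 hp0)
    (mul_ne_zero hp0 (pow_ne_zero 2 hx))).congr fun t => ?_
  have e : t ^ 2 = 2 * triExp t + t := by rw [two_mul_triExp]; ring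
  rw [thetaTerm, e, zpow_add₀ hp0, zpow_mul, zpow_mul, mul_zpow, mul_assoc, norm_mul, norm_zpow,
    norm_neg, norm_one, one_zpow, one_mul, mul_assoc]
  rfl

/-- For fixed `p`, the function `θ(xy) θ(x/y)` is an antisymmetric form of rank two. -/
lemma exists_theta_mul_theta {p : ℂ} (hp : ‖p‖ < 1) :
    ∃ (c : ℂ) (F G : ℂ → ℂ), c ≠ 0 ∧ ∀ x y : ℂ, x ≠ 0 → y ≠ 0 →
      c * (theta p (x * y) * theta p (x / y)) = x * (G x * F y - F x * G y) := by
  by_cases hp0 : p = 0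
  · refine ⟨1, fun x => 1, fun x => x + x⁻¹, one_ne_zero, fun x y hx hy => ?_⟩
    have h : ∀ z, theta p z = 1 - z := fun z => by
      have h0 : infFactorial (0 : ℂ) 0 = 1 := by simp [infFactorial]
      have h1 : infFactorial z 0 = 1 - z := by
        rw [infFactorial_eq_mul (by simp)]; simp [h0]
      subst hp0
      rw [theta, zero_div, h0, h1, mul_one]
    rw [h, h]
    field_simp
    ring
  · have hL := infFactorial_self_ne_zero hp
    -- In the double series for θ(xy)θ(x/y), with exponents (m, n), the substitution m + n = 2t or
    -- 2t + 1 separates x from y. Pairs with even sum give x G(x) F(y), pairs with odd sum give -x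
    -- F(x) G(y).
    refine ⟨infFactorial p p ^ 2, fun x => ∑' t : ℤ, p ^ (t ^ 2) * x ^ (2 * t),
      fun x => x⁻¹ * ∑' t : ℤ, p ^ (t ^ 2 - t) * x ^ (2 * t), pow_ne_zero 2 hL,
      fun x y hx hy => ?_⟩
    have hxy : x * y ≠ 0 := mul_ne_zero hx hy
    have hxy' : x / y ≠ 0 := div_ne_zero hx hy
    have hA := summable_norm_thetaTerm hp hp0 hxy
    have hB := summable_norm_thetaTerm hp hp0 hxy'
    have hS := summable_mul_of_summable_norm hA hB
    have h1 : infFactorial p p ^ 2 * (theta p (x * y) * theta p (x / y)) =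
        ∑' z : ℤ × ℤ, thetaTerm p (x * y) z.1 * thetaTerm p (x / y) z.2 := by
      rw [← tsum_mul_tsum_of_summable_norm hA hB, ← infFactorial_mul_theta hp hp0 hxy,
        ← infFactorial_mul_theta hp hp0 hxy']
      ring
    have hneg : (-1 : ℂ) ≠ 0 := by norm_num
    have hmul : ∀ m n : ℤ, (x * y) ^ m * (x / y) ^ n = x ^ (m + n) * y ^ (m - n) := fun m n => by
      rw [mul_zpow, div_zpow, zpow_add₀ hx, zpow_sub₀ hy]; ring
    have hl : ∀ z : ℤ × ℤ, thetaTerm p (x * y) (z.1 + z.2) * thetaTerm p (x / y) (z.1 - z.2) =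
        p ^ (z.1 ^ 2 - z.1) * x ^ (2 * z.1) * (p ^ (z.2 ^ 2) * y ^ (2 * z.2)) := by
      rintro ⟨t, w⟩
      have e1 : (-1 : ℂ) ^ (t + w) * (-1) ^ (t - w) = 1 := by
        rw [← zpow_add₀ hneg, show t + w + (t - w) = 2 * t by ring, zpow_mul]; simp
      have e2 : p ^ triExp (t + w) * p ^ triExp (t - w) = p ^ (t ^ 2 - t) * p ^ (w ^ 2) := by
        rw [← zpow_add₀ hp0, ← zpow_add₀ hp0]
        congr 1
        linarith [two_mul_triExp (t + w), two_mul_triExp (t - w)]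
      have e3 : (x * y) ^ (t + w) * (x / y) ^ (t - w) = x ^ (2 * t) * y ^ (2 * w) := by
        rw [hmul]; congr 2 <;> ring
      simp only [thetaTerm]
      calc _ = ((-1 : ℂ) ^ (t + w) * (-1) ^ (t - w)) * (p ^ triExp (t + w) * p ^ triExp (t - w)) *
            ((x * y) ^ (t + w) * (x / y) ^ (t - w)) := by ring
        _ = _ := by rw [e1, e2, e3]; ring
    have hr : ∀ z : ℤ × ℤ, thetaTerm p (x * y) (z.1 + z.2 + 1) * thetaTerm p (x / y) (z.1 - z.2) =
        -x * (p ^ (z.1 ^ 2) * x ^ (2 * z.1) *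
          (y⁻¹ * (p ^ ((z.2 + 1) ^ 2 - (z.2 + 1)) * y ^ (2 * (z.2 + 1))))) := by
      rintro ⟨t, w⟩
      have e1 : (-1 : ℂ) ^ (t + w + 1) * (-1) ^ (t - w) = -1 := by
        rw [← zpow_add₀ hneg, show t + w + 1 + (t - w) = 2 * t + 1 by ring, zpow_add₀ hneg, zpow_mul]
        simp
      have e2 : p ^ triExp (t + w + 1) * p ^ triExp (t - w) =
          p ^ (t ^ 2) * p ^ ((w + 1) ^ 2 - (w + 1)) := by
        rw [← zpow_add₀ hp0, ← zpow_add₀ hp0]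
        congr 1
        linarith [two_mul_triExp (t + w + 1), two_mul_triExp (t - w)]
      have e3 : (x * y) ^ (t + w + 1) * (x / y) ^ (t - w) =
          x * x ^ (2 * t) * (y⁻¹ * y ^ (2 * (w + 1))) := by
        rw [hmul, show t + w + 1 + (t - w) = 1 + 2 * t by ring,
          show t + w + 1 - (t - w) = -1 + 2 * (w + 1) by ring, zpow_add₀ hx, zpow_add₀ hy, zpow_one,
          zpow_neg_one]
      simp only [thetaTerm]
      calc _ = ((-1 : ℂ) ^ (t + w + 1) * (-1) ^ (t - w)) *
            (p ^ triExp (t + w + 1) * p ^ triExp (t - w)) *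
            ((x * y) ^ (t + w + 1) * (x / y) ^ (t - w)) := by ring
        _ = _ := by rw [e1, e2, e3]; ring
    have hF := summable_norm_zpow_sq' hp hp0 hx
    have hG := summable_norm_zpow_sq hp hp0 hx
    have hF' := summable_norm_zpow_sq' hp hp0 hy
    have hG' := summable_norm_zpow_sq hp hp0 hy
    have hG1 : Summable fun t : ℤ => ‖p ^ ((t + 1) ^ 2 - (t + 1)) * y ^ (2 * (t + 1))‖ :=
      (Equiv.addRight (1 : ℤ)).summable_iff.mpr hG'
    have hG2 : ∑' t : ℤ, p ^ ((t + 1) ^ 2 - (t + 1)) * y ^ (2 * (t + 1)) =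
        ∑' t : ℤ, p ^ (t ^ 2 - t) * y ^ (2 * t) :=
      (Equiv.addRight (1 : ℤ)).tsum_eq fun t => p ^ (t ^ 2 - t) * y ^ (2 * t)
    have hG1' : Summable fun t : ℤ =>
        ‖y⁻¹ * (p ^ ((t + 1) ^ 2 - (t + 1)) * y ^ (2 * (t + 1)))‖ := by
      simpa only [norm_mul] using hG1.mul_left ‖y⁻¹‖
    have el : (fun z : ℤ × ℤ => thetaTerm p (x * y) (parityEquiv (Sum.inl z)).1 *
        thetaTerm p (x / y) (parityEquiv (Sum.inl z)).2) = _ := funext hl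
    have er : (fun z : ℤ × ℤ => thetaTerm p (x * y) (parityEquiv (Sum.inr z)).1 *
        thetaTerm p (x / y) (parityEquiv (Sum.inr z)).2) = _ := funext hr
    rw [h1, ← parityEquiv.tsum_eq, Summable.tsum_sum, el, er]
    · rw [tsum_mul_left, ← tsum_mul_tsum_of_summable_norm hG hF',
        ← tsum_mul_tsum_of_summable_norm hF hG1', tsum_mul_left, hG2]
      field_simp
      ring
    · exact (summable_mul_of_summable_norm hG hF').congr fun z => (hl z).symm
    · exact ((summable_mul_of_summable_norm hF hG1').mul_left (-x)).congr fun z => (hr z).symm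

/-! ### The odd function and its Weierstrass relation -/

/-- The odd normalisation `exp (-u / 2) θ(exp u)` of the theta function. -/
def sigmaFn (p u : ℂ) : ℂ := Complex.exp (-u / 2) * theta p (Complex.exp u)

lemma theta_exp (p u : ℂ) : theta p (Complex.exp u) = Complex.exp (u / 2) * sigmaFn p u := by
  rw [sigmaFn, ← mul_assoc, ← Complex.exp_add]
  ring_nf
  simp

/-- The properties of the function `sigmaFn p` on which the summation formulas are based. -/
structure IsSigma (s : ℂ → ℂ) : Prop where
  neg : ∀ u, s (-u) = -s u
  weierstrass : ∀ x y u v, s (x + y) * s (x - y) * (s (u + v) * s (u - v)) +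
    s (x + u) * s (x - u) * (s (v + y) * s (v - y)) +
    s (x + v) * s (x - v) * (s (y + u) * s (y - u)) = 0
  continuous : Continuous s
  countable : {u | s u = 0}.Countable

lemma continuous_infFactorial {p : ℂ} (hp : ‖p‖ < 1) : Continuous fun a => infFactorial a p := by
  have h : HasProdLocallyUniformlyOn (fun (j : ℕ) (a : ℂ) => 1 + -(a * p ^ j))
      (fun a => ∏' j : ℕ, (1 + -(a * p ^ j))) Set.univ := by
    refine hasProdLocallyUniformlyOn_of_forall_compact isOpen_univ fun K _ hK => ?_
    obtain ⟨R, hR⟩ := hK.isBounded.exists_norm_le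
    refine ((summable_geometric_of_lt_one (norm_nonneg p) hp).mul_left
      R).hasProdUniformlyOn_nat_one_add hK (.of_forall fun j a ha => ?_) (fun _ => by fun_prop)
    rw [norm_neg, norm_mul, norm_pow]
    gcongr
    exact hR a ha
  have h2 := h.tendstoLocallyUniformlyOn_finsetRange.continuousOn
    (Frequently.of_forall fun n => by fun_prop)
  simpa [infFactorial, sub_eq_add_neg, continuousOn_univ] using h2

lemma countable_exp_eq (c : ℂ) : {u : ℂ | Complex.exp u = c}.Countable := by
  rcases Set.eq_empty_or_nonempty {u : ℂ | Complex.exp u = c} with h | ⟨w, hw⟩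
  · rw [h]; exact Set.countable_empty
  · refine (Set.countable_range fun n : ℤ => w + n * (2 * Real.pi * Complex.I)).mono fun u hu => ?_
    obtain ⟨n, hn⟩ := Complex.exp_eq_exp_iff_exists_int.mp (hu.trans hw.symm)
    exact ⟨n, hn.symm⟩

/-- Oddness is the inversion formula of θ. With c s(x+y)s(x-y) written as a 2×2 determinant in F and
G, the Weierstrass relation becomes the Plücker relation for four vectors in the plane. Zeros force
exp u to be one of the countably many numbers p^(-j), p^(j+1). -/
lemma isSigma_sigmaFn {p : ℂ} (hp : ‖p‖ < 1) : IsSigma (sigmaFn p) where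
  neg u := by
    rw [sigmaFn, sigmaFn, Complex.exp_neg u, theta_inv hp (Complex.exp_ne_zero u),
      ← Complex.exp_neg, ← mul_assoc, mul_neg, ← Complex.exp_add]
    ring_nf
  weierstrass := by
    obtain ⟨c, F, G, hc, h⟩ := exists_theta_mul_theta hp
    have key : ∀ x y, c * (sigmaFn p (x + y) * sigmaFn p (x - y)) =
        G (Complex.exp x) * F (Complex.exp y) - F (Complex.exp x) * G (Complex.exp y) := by
      intro x y
      have hx := Complex.exp_ne_zero x
      have := h _ _ hx (Complex.exp_ne_zero y)
      rw [← Complex.exp_add, ← Complex.exp_sub] at this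
      have e : Complex.exp (-(x + y) / 2) * Complex.exp (-(x - y) / 2) * Complex.exp x = 1 := by
        rw [← Complex.exp_add, ← Complex.exp_add]; ring_nf; simp
      rw [sigmaFn, sigmaFn]
      linear_combination Complex.exp (-(x + y) / 2) * Complex.exp (-(x - y) / 2) * this +
        (G (Complex.exp x) * F (Complex.exp y) - F (Complex.exp x) * G (Complex.exp y)) * e
    intro x y u v
    have hc2 : c ^ 2 ≠ 0 := pow_ne_zero 2 hc
    apply mul_left_cancel₀ hc2
    have e : ∀ A B C D E F : ℂ, c ^ 2 * (A * B + C * D + E * F) =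
        (c * A) * (c * B) + (c * C) * (c * D) + (c * E) * (c * F) := by intros; ring
    rw [e, key, key, key, key, key, key]
    ring
  continuous := by
    have h := continuous_infFactorial hp
    unfold sigmaFn theta
    refine Continuous.mul (by fun_prop) ((h.comp Complex.continuous_exp).mul (h.comp ?_))
    exact continuous_const.div Complex.continuous_exp Complex.exp_ne_zero
  countable := by
    have : {u | sigmaFn p u = 0} ⊆ (⋃ j : ℕ, {u | Complex.exp u = (p ^ j)⁻¹}) ∪
        ⋃ j : ℕ, {u | Complex.exp u = p * p ^ j} := by
      intro u hu
      by_contra hcon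
      simp only [Set.mem_union, Set.mem_iUnion, Set.mem_ofPred_eq, not_or, not_exists] at hcon
      have h0 := Complex.exp_ne_zero u
      refine mul_ne_zero (Complex.exp_ne_zero _) (mul_ne_zero (infFactorial_ne_zero hp fun j hj => ?_)
        (infFactorial_ne_zero hp fun j hj => ?_)) hu
      · exact hcon.1 j (eq_inv_of_mul_eq_one_left hj)
      · refine hcon.2 j ?_
        field_simp at hj
        exact hj.symm
    exact ((Set.countable_iUnion fun j => countable_exp_eq _).union
      (Set.countable_iUnion fun j => countable_exp_eq _)).mono this

/-! ### Three-term relation and partial fractions -/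

namespace IsSigma

variable {s : ℂ → ℂ}

lemma zero (hs : IsSigma s) : s 0 = 0 := by
  have := hs.neg 0
  rw [neg_zero] at this
  exact self_eq_neg.mp this

lemma sub_comm (hs : IsSigma s) (u v : ℂ) : s (u - v) = -s (v - u) := by
  rw [← hs.neg, neg_sub]

/-- Weierstrass recentred at (b₀ + b₁)/2. It exchanges the zeros b₀, b₁ of a product in x for a pair
containing u, or one containing v, with the same sum. -/
lemma three_term (hs : IsSigma s) (x b₀ b₁ u v : ℂ) :
    s (x - b₀) * s (x - b₁) * (s (u + v - b₀ - b₁) * s (u - v)) =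
      s (x - u) * s (x - (b₀ + b₁ - u)) * (s (v - b₀) * s (b₁ - v)) +
      s (x - v) * s (x - (b₀ + b₁ - v)) * (s (u - b₀) * s (u - b₁)) := by
  have h := hs.weierstrass (x - (b₀ + b₁) / 2) ((b₀ - b₁) / 2) (u - (b₀ + b₁) / 2)
    (v - (b₀ + b₁) / 2)
  have e1 : x - (b₀ + b₁) / 2 + (b₀ - b₁) / 2 = x - b₁ := by ring
  have e2 : x - (b₀ + b₁) / 2 - (b₀ - b₁) / 2 = x - b₀ := by ring
  have e3 : u - (b₀ + b₁) / 2 + (v - (b₀ + b₁) / 2) = u + v - b₀ - b₁ := by ring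
  have e4 : u - (b₀ + b₁) / 2 - (v - (b₀ + b₁) / 2) = u - v := by ring
  have e5 : x - (b₀ + b₁) / 2 + (u - (b₀ + b₁) / 2) = x - (b₀ + b₁ - u) := by ring
  have e6 : x - (b₀ + b₁) / 2 - (u - (b₀ + b₁) / 2) = x - u := by ring
  have e7 : v - (b₀ + b₁) / 2 + (b₀ - b₁) / 2 = v - b₁ := by ring
  have e8 : v - (b₀ + b₁) / 2 - (b₀ - b₁) / 2 = v - b₀ := by ring
  have e9 : x - (b₀ + b₁) / 2 + (v - (b₀ + b₁) / 2) = x - (b₀ + b₁ - v) := by ring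
  have e10 : x - (b₀ + b₁) / 2 - (v - (b₀ + b₁) / 2) = x - v := by ring
  have e11 : (b₀ - b₁) / 2 + (u - (b₀ + b₁) / 2) = u - b₁ := by ring
  have e12 : (b₀ - b₁) / 2 - (u - (b₀ + b₁) / 2) = b₀ - u := by ring
  rw [e1, e2, e3, e4, e5, e6, e7, e8, e9, e10, e11, e12, hs.sub_comm b₀ u,
    hs.sub_comm v b₁] at h
  linear_combination h

lemma countable_add (hs : IsSigma s) (c : ℂ) : {t : ℂ | s (c + t) = 0}.Countable :=
  hs.countable.preimage (add_right_injective c)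

lemma countable_sub (hs : IsSigma s) (c : ℂ) : {t : ℂ | s (c - t) = 0}.Countable :=
  hs.countable.preimage (sub_right_injective (b := c))

end IsSigma

/-- A continuous function vanishing off a countable set vanishes identically. -/
lemma eq_zero_of_countable {f : ℂ → ℂ} (hf : Continuous f) {Z : Set ℂ} (hZ : Z.Countable)
    (h : ∀ t ∉ Z, f t = 0) (t : ℂ) : f t = 0 :=
  congrFun (hf.ext_on (hZ.dense_compl ℝ) continuous_const h) t

/-- The partial fraction identity of type `A`. -/
lemma IsSigma.sum_prod_div_prod_eq_zero {s : ℂ → ℂ} (hs : IsSigma s) {ι : Type*} [DecidableEq ι]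
    (n : ℕ) : ∀ (I : Finset ι) (a : ι → ℂ) (b : Multiset ℂ), #I = n → b.card = n →
    b.sum = ∑ i ∈ I, a i → (∀ i ∈ I, ∀ j ∈ I, i ≠ j → s (a i - a j) ≠ 0) →
    ∑ i ∈ I, (b.map fun c => s (a i - c)).prod / ∏ j ∈ I.erase i, s (a i - a j) = 0 := by
  induction n with
  | zero => intro I a b hI _ _ _; simp [card_eq_zero.mp hI]
  | succ n ih =>
    -- generic case
    have generic : ∀ (I : Finset ι) (a : ι → ℂ) (i₀ i₁ : ι) (b₀ b₁ : ℂ) (b : Multiset ℂ),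
        #I = n + 1 → b.card + 2 = n + 1 → b₀ + b₁ + b.sum = ∑ i ∈ I, a i →
        (∀ i ∈ I, ∀ j ∈ I, i ≠ j → s (a i - a j) ≠ 0) → i₀ ∈ I → i₁ ∈ I → i₀ ≠ i₁ →
        s (a i₀ + a i₁ - b₀ - b₁) ≠ 0 →
        ∑ i ∈ I, s (a i - b₀) * s (a i - b₁) * (b.map fun c => s (a i - c)).prod /
          ∏ j ∈ I.erase i, s (a i - a j) = 0 := by
      intro I a i₀ i₁ b₀ b₁ b hI hb hsum hne h0 h1 h01 hgen
      -- Once a k is among the zeros, the term i = k drops out and s(a i - a k) cancels from the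
      -- other denominators. What remains is the identity for I without k.
      have step : ∀ k ∈ I, ∑ i ∈ I, s (a i - a k) * s (a i - (b₀ + b₁ - a k)) *
          (b.map fun c => s (a i - c)).prod / ∏ j ∈ I.erase i, s (a i - a j) = 0 := by
        intro k hk
        have := ih (I.erase k) a ((b₀ + b₁ - a k) ::ₘ b) (by rw [card_erase_of_mem hk]; omega)
          (by simp; omega) (by rw [Multiset.sum_cons, sum_erase_eq_sub hk, ← hsum]; ring)
          (fun i hi j hj => hne i (mem_of_mem_erase hi) j (mem_of_mem_erase hj))
        rw [← add_sum_erase _ _ hk, sub_self, hs.zero, zero_mul, zero_mul, zero_div, zero_add,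
          ← this]
        refine sum_congr rfl fun i hi => ?_
        have hik : i ≠ k := ne_of_mem_erase hi
        have hki : k ∈ I.erase i := mem_erase.mpr ⟨hik.symm, hk⟩
        rw [Multiset.map_cons, Multiset.prod_cons, ← mul_prod_erase _ _ hki, erase_right_comm,
          mul_assoc, mul_div_mul_left _ _ (hne i (mem_of_mem_erase hi) k hk hik)]
      have hE : s (a i₀ + a i₁ - b₀ - b₁) * s (a i₀ - a i₁) ≠ 0 := mul_ne_zero hgen (hne _ h0 _ h1 h01)
      apply (mul_eq_zero_iff_left hE).mp
      rw [mul_comm, sum_mul]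
      calc _ = ∑ i ∈ I, ((s (a i - a i₀) * s (a i - (b₀ + b₁ - a i₀)) *
              (b.map fun c => s (a i - c)).prod / ∏ j ∈ I.erase i, s (a i - a j)) *
              (s (a i₁ - b₀) * s (b₁ - a i₁)) +
            (s (a i - a i₁) * s (a i - (b₀ + b₁ - a i₁)) *
              (b.map fun c => s (a i - c)).prod / ∏ j ∈ I.erase i, s (a i - a j)) *
              (s (a i₀ - b₀) * s (a i₀ - b₁))) := by
            refine sum_congr rfl fun i _ => ?_
            have := hs.three_term (a i) b₀ b₁ (a i₀) (a i₁)
            rw [div_mul_eq_mul_div, div_mul_eq_mul_div, div_mul_eq_mul_div, ← add_div]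
            congr 1
            linear_combination (b.map fun c => s (a i - c)).prod * this
        _ = 0 := by rw [sum_add_distrib, ← sum_mul, ← sum_mul, step _ h0, step _ h1]; ring
    intro I a b hI hb hsum hne
    -- With two points the sum condition gives s(a i₀ + a i₁ - b₀ - b₁) = s 0 = 0, so `generic` is
    -- unavailable and oddness settles the matter directly.
    rcases n with _ | _ | n
    · obtain ⟨i, rfl⟩ := card_eq_one.mp hI
      obtain ⟨c, rfl⟩ := Multiset.card_eq_one.mp hb
      have : c = a i := by simpa using hsum
      simp [this, hs.zero]
    · obtain ⟨i, j, hij, rfl⟩ := card_eq_two.mp hI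
      obtain ⟨c, d, rfl⟩ := Multiset.card_eq_two.mp hb
      have h : c + d = a i + a j := by
        rw [sum_pair hij] at hsum; simpa using hsum
      have h1 : ({i, j} : Finset ι).erase i = {j} := erase_insert (by simpa using hij)
      have h2 : ({i, j} : Finset ι).erase j = {i} := by
        rw [pair_comm]; exact erase_insert (by simpa using hij.symm)
      have hd : s (a i - a j) ≠ 0 := hne i (by simp) j (by simp) hij
      have hd' := hs.sub_comm (a j) (a i)
      have e1 : a i - d = c - a j := by linear_combination -h
      have e2 : a j - d = c - a i := by linear_combination -h
      rw [sum_pair hij, h1, h2, prod_singleton, prod_singleton, hd']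
      simp only [Multiset.insert_eq_cons, Multiset.map_cons, Multiset.prod_cons,
        Multiset.map_singleton, Multiset.prod_singleton]
      rw [e1, e2, hs.sub_comm c (a i), hs.sub_comm c (a j)]
      field_simp
      ring
    · obtain ⟨i₀, h0, i₁, h1, h01⟩ := one_lt_card.mp (show 1 < #I by omega)
      obtain ⟨b₀, b', rfl, hb₁⟩ := Multiset.card_eq_succ_iff.mp hb
      obtain ⟨b₁, b'', rfl, hb₂⟩ := Multiset.card_eq_succ_iff.mp hb₁
      obtain ⟨b₂, b''', rfl, hb₃⟩ := Multiset.card_eq_succ_iff.mp hb₂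
      -- Moving b₀ by t and b₂ by -t keeps the sum, and makes the generic condition true for all but
      -- countably many t.
      have := eq_zero_of_countable (f := fun t => ∑ i ∈ I, s (a i - (b₀ + t)) * s (a i - b₁) *
        (((b₂ - t) ::ₘ b''').map fun c => s (a i - c)).prod / ∏ j ∈ I.erase i, s (a i - a j)) ?_
        (hs.countable_sub (a i₀ + a i₁ - b₀ - b₁)) ?_ 0
      · simpa [mul_assoc] using this
      · have := hs.continuous
        simp only [Multiset.map_cons, Multiset.prod_cons]
        fun_prop
      · intro t ht
        refine generic I a i₀ i₁ (b₀ + t) b₁ ((b₂ - t) ::ₘ b''') hI (by simp [hb₃]) ?_ hne h0 h1 h01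
          fun h => ht ?_
        · rw [← hsum]; simp only [Multiset.sum_cons]; ring
        · rw [Set.mem_ofPred_eq, ← h]; congr 1; ring

/-! ### Interpolation in spaces of theta products -/

/-- The span of the products `∏ s(y - c)` of `D` factors with `∑ c = β`. -/
def thetaSpace (s : ℂ → ℂ) (D : ℕ) (β : ℂ) : Submodule ℂ (ℂ → ℂ) :=
  Submodule.span ℂ {g | ∃ b : Multiset ℂ, b.card = D ∧ b.sum = β ∧
    g = fun y => (b.map fun c => s (y - c)).prod}

variable {s : ℂ → ℂ}

lemma one_mem_thetaSpace : (fun _ => 1 : ℂ → ℂ) ∈ thetaSpace s 0 0 :=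
  Submodule.subset_span ⟨0, by simp⟩

lemma sub_mem_thetaSpace (c : ℂ) : (fun y => s (y - c)) ∈ thetaSpace s 1 c :=
  Submodule.subset_span ⟨{c}, by simp⟩

lemma add_mem_thetaSpace (c : ℂ) : (fun y => s (y + c)) ∈ thetaSpace s 1 (-c) := by
  simpa using sub_mem_thetaSpace (s := s) (-c)

lemma mul_mem_thetaSpace {D D' : ℕ} {β β' : ℂ} {f g : ℂ → ℂ} (hf : f ∈ thetaSpace s D β)
    (hg : g ∈ thetaSpace s D' β') : (fun y => f y * g y) ∈ thetaSpace s (D + D') (β + β') := by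
  change f * g ∈ _
  induction hf using Submodule.span_induction with
  | zero => simp
  | add f₁ f₂ _ _ h₁ h₂ => rw [add_mul]; exact add_mem h₁ h₂
  | smul r f _ h => rw [smul_mul_assoc]; exact Submodule.smul_mem _ _ h
  | mem f hf =>
    obtain ⟨b, rfl, rfl, rfl⟩ := hf
    induction hg using Submodule.span_induction with
    | zero => simp
    | add f₁ f₂ _ _ h₁ h₂ => rw [mul_add]; exact add_mem h₁ h₂
    | smul r f _ h => rw [mul_smul_comm]; exact Submodule.smul_mem _ _ h
    | mem g hg =>
      obtain ⟨b', rfl, rfl, rfl⟩ := hg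
      exact Submodule.subset_span ⟨b + b', by simp, by simp, by ext; simp⟩

lemma const_mul_mem_thetaSpace {D : ℕ} {β : ℂ} {f : ℂ → ℂ} (r : ℂ) (hf : f ∈ thetaSpace s D β) :
    (fun y => r * f y) ∈ thetaSpace s D β :=
  Submodule.smul_mem _ r hf

lemma prod_add_mem_thetaSpace {ι : Type*} [DecidableEq ι] (T : Finset ι) (c : ι → ℂ) :
    (fun y => ∏ u ∈ T, s (y + c u)) ∈ thetaSpace s #T (-∑ u ∈ T, c u) := by
  induction T using Finset.induction_on with
  | empty => simpa using one_mem_thetaSpace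
  | insert t T ht ih =>
    simp only [prod_insert ht, sum_insert ht, card_insert_of_notMem ht]
    have := mul_mem_thetaSpace (add_mem_thetaSpace (s := s) (c t)) ih
    rwa [add_comm 1, ← neg_add] at this

/-- An element of `thetaSpace s D β` with `D` zeros, whose sum is not the forced one, vanishes. -/
lemma IsSigma.eq_zero_of_mem_thetaSpace (hs : IsSigma s) {ι : Type*} [DecidableEq ι]
    {I : Finset ι} {a : ι → ℂ} {β : ℂ} {f : ℂ → ℂ} (hf : f ∈ thetaSpace s #I β)
    (hne : ∀ i ∈ I, ∀ j ∈ I, i ≠ j → s (a i - a j) ≠ 0)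
    (hβ : s (∑ i ∈ I, a i - β) ≠ 0) (hz : ∀ i ∈ I, f (a i) = 0)
    {y : ℂ} (hy : ∀ i ∈ I, s (y - a i) ≠ 0) : f y = 0 := by
  set Z := ∑ i ∈ I, a i with hZ
  -- Interpolation formula, linear in f, so it suffices to check it on products. There it is the
  -- partial fraction identity at the points y and a i, with the extra parameter y + Z - β chosen to
  -- balance the sums.
  have key : f y * (s (β - Z) / ∏ j ∈ I, s (y - a j)) + ∑ i ∈ I, f (a i) *
      (s (a i - (y + Z - β)) / (s (a i - y) * ∏ j ∈ I.erase i, s (a i - a j))) = 0 := by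
    clear hz
    induction hf using Submodule.span_induction with
    | zero => simp
    | add f₁ f₂ _ _ h₁ h₂ =>
      simp only [Pi.add_apply, add_mul, sum_add_distrib]
      linear_combination h₁ + h₂
    | smul r f _ h =>
      simp only [Pi.smul_apply, smul_eq_mul, mul_assoc, ← mul_sum]
      rw [← mul_add, h, mul_zero]
    | mem f hf =>
      obtain ⟨b, hb, rfl, rfl⟩ := hf
      have := hs.sum_prod_div_prod_eq_zero (#I + 1) (insertNone I) (fun o => o.elim y a)
        ((y + Z - b.sum) ::ₘ b) (by simp) (by simp [hb])
        (by rw [sum_insertNone, Multiset.sum_cons]; simp [← hZ]) (by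
          rintro (_ | i) hi (_ | j) hj hij
          · exact absurd rfl hij
          · exact hy j (by simpa using hj)
          · rw [hs.sub_comm]; exact neg_ne_zero.mpr (hy i (by simpa using hi))
          · exact hne i (by simpa using hi) j (by simpa using hj) (by simpa using hij))
      rw [sum_insertNone] at this
      simp only [Option.elim, Multiset.map_cons, Multiset.prod_cons] at this
      rw [← this]
      have e1 : (insertNone I).erase none = I.map Function.Embedding.some := by
        ext o; cases o <;> simp
      have e2 : ∀ i ∈ I, ∏ j ∈ (insertNone I).erase (some i), s (a i - j.elim y a) =
          s (a i - y) * ∏ j ∈ I.erase i, s (a i - a j) := by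
        intro i hi
        have : (insertNone I).erase (some i) = insertNone (I.erase i) := by
          ext o; cases o <;> simp
        rw [this, prod_insertNone]
        rfl
      congr 1
      · rw [e1, prod_map, show y - (y + Z - b.sum) = b.sum - Z by ring]
        simp only [Function.Embedding.some_apply]
        ring
      · refine sum_congr rfl fun i hi => ?_
        have := e2 i hi
        simp only [Option.elim] at this
        rw [this]
        ring
  rw [sum_eq_zero fun i hi => by rw [hz i hi, zero_mul], add_zero] at key
  refine (mul_eq_zero.mp key).resolve_right (div_ne_zero ?_ (prod_ne_zero_iff.mpr hy))
  rw [hs.sub_comm]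
  exact neg_ne_zero.mpr hβ

/-! ### Terms of the Jackson sum over subsets -/

/-- The shifted factorial `s(u) s(u + h) ⋯ s(u + (k - 1) h)`. -/
def rise (s : ℂ → ℂ) (h u : ℂ) (k : ℕ) : ℂ := ∏ i ∈ range k, s (u + i * h)

lemma rise_succ (s : ℂ → ℂ) (h u : ℂ) (k : ℕ) : rise s h u (k + 1) = rise s h u k * s (u + k * h) :=
  prod_range_succ _ _

lemma rise_succ' (s : ℂ → ℂ) (h u : ℂ) (k : ℕ) :
    rise s h u (k + 1) = s u * rise s h (u + h) k := by
  rw [rise, prod_range_succ', mul_comm]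
  congr 1
  · simp
  · refine prod_congr rfl fun i _ => congrArg s ?_
    push_cast; ring

section Terms

variable {ι : Type*}

/-- The interaction factor of the variables in `S` with those in `R`. -/
def crossProd (s : ℂ → ℂ) (h : ℂ) (x : ι → ℂ) (S R : Finset ι) : ℂ :=
  ∏ u ∈ S, ∏ v ∈ R, s (x v - x u + h) / s (x v - x u)

/-- The product over `S` of the quotients `s(x + α) s(x + β) / s(x + γ)`. -/
def ratioProd (s : ℂ → ℂ) (x : ι → ℂ) (α β γ : ℂ) (S : Finset ι) : ℂ :=
  ∏ u ∈ S, s (x u + α) * s (x u + β) / s (x u + γ)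

/-- The factor of a term of the Jackson sum that depends only on the number of elements. -/
def jacksonWeight (s : ℂ → ℂ) (h b c f : ℂ) (m k : ℕ) : ℂ :=
  rise s h b k * rise s h c k * rise s h (b + c + f + k * h) (m - k) * rise s h f (m - k)

variable {s : ℂ → ℂ} {h : ℂ} {x : ι → ℂ}

lemma crossProd_insert_left [DecidableEq ι] {t : ι} {S : Finset ι} (ht : t ∉ S) (R : Finset ι) :
    crossProd s h x (insert t S) R =
      (∏ v ∈ R, s (x v - x t + h) / s (x v - x t)) * crossProd s h x S R :=
  prod_insert ht

lemma crossProd_insert_right [DecidableEq ι] {t : ι} {R : Finset ι} (ht : t ∉ R) (S : Finset ι) :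
    crossProd s h x S (insert t R) =
      (∏ u ∈ S, s (x t - x u + h) / s (x t - x u)) * crossProd s h x S R := by
  simp only [crossProd, prod_insert ht, prod_mul_distrib]

lemma ratioProd_insert [DecidableEq ι] {t : ι} {S : Finset ι} (ht : t ∉ S) (α β γ : ℂ) :
    ratioProd s x α β γ (insert t S) =
      s (x t + α) * s (x t + β) / s (x t + γ) * ratioProd s x α β γ S :=
  prod_insert ht

/-- At y = -(g + kh) the factors of `polyOut` and `polyIn` cancel the denominators of `ratioProd` up
to sign, which makes the two parts of the sum comparable. -/
lemma ratioProd_mul_prod {S : Finset ι} {α β γ : ℂ} {φ : ι → ℂ}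
    (hγ : ∀ u ∈ S, s (x u + γ) ≠ 0) (hφ : ∀ u ∈ S, s (φ u) = -s (x u + γ)) :
    ratioProd s x α β γ S * ∏ u ∈ S, s (φ u) = ∏ u ∈ S, -(s (x u + α) * s (x u + β)) := by
  rw [ratioProd, ← prod_mul_distrib]
  refine prod_congr rfl fun u hu => ?_
  rw [hφ u hu]
  have := hγ u hu
  field_simp

lemma IsSigma.prod_div_mul_prod (hs : IsSigma s) {R : Finset ι} {y : ℂ}
    (hy : ∀ v ∈ R, s (y - x v) ≠ 0) :
    (∏ v ∈ R, s (x v - y + h) / s (x v - y)) * ∏ v ∈ R, s (y - x v) =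
      ∏ v ∈ R, s (y - x v - h) := by
  rw [← prod_mul_distrib]
  refine prod_congr rfl fun v hv => ?_
  have := hy v hv
  rw [hs.sub_comm (x v) y, show x v - y + h = -(y - x v - h) by ring, hs.neg]
  field_simp

lemma prod_div_mul_prod {S : Finset ι} {y : ℂ} (hy : ∀ u ∈ S, s (y - x u) ≠ 0) :
    (∏ u ∈ S, s (y - x u + h) / s (y - x u)) * ∏ u ∈ S, s (y - x u) =
      ∏ u ∈ S, s (y - x u + h) := by
  rw [← prod_mul_distrib]
  exact prod_congr rfl fun u hu => div_mul_cancel₀ _ (hy u hu)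

lemma jacksonWeight_succ_left {m k : ℕ} (hk : k ≤ m) (b c f : ℂ) :
    jacksonWeight s h b c f (m + 1) k =
      s (b + c + f + k * h) * s f * jacksonWeight s h b c (f + h) m k := by
  rw [jacksonWeight, jacksonWeight, Nat.sub_add_comm hk, rise_succ', rise_succ',
    show b + c + f + k * h + h = b + c + (f + h) + k * h by ring]
  ring

/-- This relation between adjacent weights is what cancels the terms without and with the new
variable at y = -(g + kh). -/
lemma IsSigma.jacksonWeight_succ (hs : IsSigma s) {m k : ℕ} (hk : k ≤ m) (b c f : ℂ) :
    jacksonWeight s h b c f (m + 1) k * (s (-(b + k * h)) * s (-(c + k * h))) +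
      jacksonWeight s h b c f (m + 1) (k + 1) *
        (s (-(b + c + f + k * h)) * s (f + ((m - k : ℕ) : ℂ) * h)) = 0 := by
  rw [jacksonWeight, jacksonWeight, Nat.sub_add_comm hk, Nat.add_sub_add_right, rise_succ',
    rise_succ s h f, rise_succ s h b, rise_succ s h c, hs.neg, hs.neg, hs.neg,
    show b + c + f + k * h + h = b + c + f + ((k + 1 : ℕ) : ℂ) * h by push_cast; ring]
  ring

variable [DecidableEq ι]

variable (s h x)

/-- The term of the Jackson sum over the subsets of `T` that belongs to `S`. -/
def jacksonTerm (b c d f g : ℂ) (T S : Finset ι) : ℂ :=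
  crossProd s h x S (T \ S) *
    ratioProd s x d (g + f + ((#T : ℂ) - 1) * h) (g + ((#S : ℂ) - 1) * h) S *
    ratioProd s x (g - b) (g - c) (g + #S * h) (T \ S) * jacksonWeight s h b c f #T #S

/-- The coefficient of the part of the cleared Jackson sum without the new variable. -/
def coeffOut (b c d f g : ℂ) (T S : Finset ι) : ℂ :=
  crossProd s h x S (T \ S) *
    ratioProd s x d (g + f + #T * h) (g + ((#S : ℂ) - 1) * h) S *
    ratioProd s x (g - b) (g - c) (g + #S * h) (T \ S) * jacksonWeight s h b c f (#T + 1) #S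

/-- The coefficient of the part of the cleared Jackson sum with the new variable. -/
def coeffIn (b c d f g : ℂ) (T S : Finset ι) : ℂ :=
  crossProd s h x S (T \ S) *
    ratioProd s x d (g + f + #T * h) (g + #S * h) S *
    ratioProd s x (g - b) (g - c) (g + ((#S : ℂ) + 1) * h) (T \ S) *
    jacksonWeight s h b c f (#T + 1) (#S + 1)

/-- The dependence on the new variable of the part of the cleared sum without it. -/
def polyOut (b c g : ℂ) (T S : Finset ι) (y : ℂ) : ℂ :=
  (∏ u ∈ S, s (y - x u + h)) * (∏ v ∈ T \ S, s (y - x v)) * (s (y + (g - b)) * s (y + (g - c))) *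
    ∏ i ∈ (range (#T + 1)).erase #S, s (y + (g + i * h))

/-- The dependence on the new variable of the part of the cleared sum with it. -/
def polyIn (d f g : ℂ) (T S : Finset ι) (y : ℂ) : ℂ :=
  (∏ u ∈ S, s (y - x u)) * (∏ v ∈ T \ S, s (y - x v - h)) *
    (s (y + d) * s (y + (g + f + #T * h))) *
    ∏ i ∈ (range (#T + 1)).erase #S, s (y + (g + i * h))

/-- The common denominator. -/
def polyDen (g : ℂ) (T : Finset ι) (y : ℂ) : ℂ :=
  (∏ u ∈ T, s (y - x u)) * ∏ i ∈ range (#T + 1), s (y + (g + i * h))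

/-- The difference of the two sides of the Jackson sum, cleared of denominators. -/
def jacksonDefect (b c d f g : ℂ) (T : Finset ι) (y : ℂ) : ℂ :=
  ∑ S ∈ T.powerset, (coeffOut s h x b c d f g T S * polyOut s h x b c g T S y +
    coeffIn s h x b c d f g T S * polyIn s h x d f g T S y) -
  rise s h (b + f) (#T + 1) * rise s h (c + f) (#T + 1) * (∏ u ∈ T, s (x u + (d + f))) *
    (s (y + (d + f)) * polyDen s h x g T y)

variable {s h x}

lemma sum_erase_range (g : ℂ) {m k : ℕ} (hk : k ≤ m) :
    ∑ i ∈ (range (m + 1)).erase k, (g + (i : ℂ) * h) =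
      ∑ i ∈ range (m + 1), (g + (i : ℂ) * h) - (g + k * h) :=
  sum_erase_eq_sub (by simpa [Nat.lt_succ_iff] using hk)

lemma prod_erase_range (g y : ℂ) {m k : ℕ} (hk : k ≤ m) :
    s (y + (g + k * h)) * ∏ i ∈ (range (m + 1)).erase k, s (y + (g + i * h)) =
      ∏ i ∈ range (m + 1), s (y + (g + i * h)) :=
  mul_prod_erase _ (fun i : ℕ => s (y + (g + i * h))) (by simpa [Nat.lt_succ_iff] using hk)

/-- Every summand has #S + #(T \ S) + 2 + #T = 2#T + 2 factors in y, as has the closed form. The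
sums of zeros agree for all S; for `polyOut` this is the balancing condition on g. -/
lemma jacksonDefect_mem {b c d f g : ℂ} (hg : g = b + c + d + f) (T : Finset ι) :
    jacksonDefect s h x b c d f g T ∈ thetaSpace s (#T + (#T + 1) + 1)
      (∑ u ∈ T, x u - d - f - ∑ i ∈ range (#T + 1), (g + (i : ℂ) * h)) := by
  have cast : ∀ {D D' : ℕ} {β β' : ℂ} {F G : ℂ → ℂ}, F ∈ thetaSpace s D β → F = G → D = D' →
      β = β' → G ∈ thetaSpace s D' β' := by
    rintro D D' β β' F G hF rfl rfl rfl; exact hF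
  refine Submodule.sub_mem _ ?_ (const_mul_mem_thetaSpace _ ?_)
  · have : (fun y => ∑ S ∈ T.powerset, (coeffOut s h x b c d f g T S * polyOut s h x b c g T S y +
      coeffIn s h x b c d f g T S * polyIn s h x d f g T S y)) =
      ∑ S ∈ T.powerset, ((fun y => coeffOut s h x b c d f g T S * polyOut s h x b c g T S y) +
      fun y => coeffIn s h x b c d f g T S * polyIn s h x d f g T S y) := by
      ext y; simp
    rw [this]
    refine Submodule.sum_mem _ fun S hS => Submodule.add_mem _ (const_mul_mem_thetaSpace _ ?_)
      (const_mul_mem_thetaSpace _ ?_)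
    all_goals
      have hST := mem_powerset.mp hS
      have hk : #S ≤ #T := card_le_card hST
      have hc : #(T \ S) + #S = #T := card_sdiff_add_card_eq_card hST
      have hc' : (#(T \ S) : ℂ) + #S = #T := by exact_mod_cast hc
      have hsum : ∑ u ∈ T \ S, x u + ∑ u ∈ S, x u = ∑ u ∈ T, x u := sum_sdiff hST
      have he : #((range (#T + 1)).erase #S) = #T := by
        rw [card_erase_of_mem (by simpa [Nat.lt_succ_iff] using hk), card_range]; simp
    · refine cast (mul_mem_thetaSpace (mul_mem_thetaSpace (mul_mem_thetaSpace
        (prod_add_mem_thetaSpace S fun u => -x u + h)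
        (prod_add_mem_thetaSpace (T \ S) fun u => -x u))
        (mul_mem_thetaSpace (add_mem_thetaSpace (g - b)) (add_mem_thetaSpace (g - c))))
        (prod_add_mem_thetaSpace ((range (#T + 1)).erase #S) fun i => g + i * h)) ?_ ?_ ?_
      · ext y
        simp only [polyOut, sub_eq_add_neg, add_assoc]
      · rw [he]; omega
      · rw [sum_erase_range g hk, sum_add_distrib, sum_const, sum_neg_distrib, sum_neg_distrib,
          nsmul_eq_mul]
        linear_combination hsum - hg
    · refine cast (mul_mem_thetaSpace (mul_mem_thetaSpace (mul_mem_thetaSpace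
        (prod_add_mem_thetaSpace S fun u => -x u)
        (prod_add_mem_thetaSpace (T \ S) fun u => -x u + -h))
        (mul_mem_thetaSpace (add_mem_thetaSpace d) (add_mem_thetaSpace (g + f + #T * h))))
        (prod_add_mem_thetaSpace ((range (#T + 1)).erase #S) fun i => g + i * h)) ?_ ?_ ?_
      · ext y
        simp only [polyIn, sub_eq_add_neg, add_assoc]
      · rw [he]; omega
      · rw [sum_erase_range g hk, sum_add_distrib, sum_const, sum_neg_distrib, sum_neg_distrib,
          nsmul_eq_mul]
        linear_combination hsum + h * hc'
  · refine cast (mul_mem_thetaSpace (add_mem_thetaSpace (d + f)) (mul_mem_thetaSpace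
      (prod_add_mem_thetaSpace T fun u => -x u)
      (prod_add_mem_thetaSpace (range (#T + 1)) fun i => g + i * h))) ?_ ?_ ?_
    · ext y
      simp only [polyDen, sub_eq_add_neg]
    · rw [card_range]; omega
    · rw [sum_neg_distrib]; ring

end Terms

/-! ### Zeros of the cleared difference -/

section Zeros

variable {ι : Type*} {s : ℂ → ℂ} {h : ℂ} {x : ι → ℂ} {T : Finset ι}

lemma polyDen_eq_zero_of_mem (hs : IsSigma s) {t : ι} (ht : t ∈ T) (g : ℂ) :
    polyDen s h x g T (x t) = 0 := by
  rw [polyDen, prod_eq_zero ht (by rw [sub_self, hs.zero]), zero_mul]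

variable [DecidableEq ι]

/-- When the new variable equals x t, only subsets containing exactly one of the two survive.
Exchanging the two pairs these subsets off, and s(-h) = -s(h) makes each pair cancel. -/
lemma jacksonDefect_eq_zero_of_mem (hs : IsSigma s) {b c d f g : ℂ} {t : ι} (ht : t ∈ T)
    (hxx : ∀ u ∈ T, ∀ v ∈ T, u ≠ v → s (x u - x v) ≠ 0)
    (hxg : ∀ i ≤ #T, s (x t + (g + (i : ℂ) * h)) ≠ 0) :
    jacksonDefect s h x b c d f g T (x t) = 0 := by
  rw [jacksonDefect, polyDen_eq_zero_of_mem hs ht, mul_zero, mul_zero, sub_zero]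
  obtain ⟨T₀, ht₀, rfl⟩ : ∃ T₀, t ∉ T₀ ∧ insert t T₀ = T :=
    ⟨T.erase t, notMem_erase t T, insert_erase ht⟩
  rw [sum_powerset_insert ht₀, ← sum_add_distrib]
  refine sum_eq_zero fun S hS => ?_
  have hST := mem_powerset.mp hS
  have htS : t ∉ S := fun h => ht₀ (hST h)
  have htR : t ∉ T₀ \ S := fun h => ht₀ (sdiff_subset h)
  have e1 : insert t T₀ \ S = insert t (T₀ \ S) := insert_sdiff_of_notMem _ htS
  have e2 : insert t T₀ \ insert t S = T₀ \ S := by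
    rw [insert_sdiff_insert, sdiff_insert_of_notMem ht₀]
  have h1 : polyOut s h x b c g (insert t T₀) S (x t) = 0 := by
    rw [polyOut, e1, prod_insert htR, sub_self, hs.zero]; ring
  have h2 : polyIn s h x d f g (insert t T₀) (insert t S) (x t) = 0 := by
    rw [polyIn, prod_insert htS, sub_self, hs.zero]; ring
  rw [h1, h2, mul_zero, mul_zero, zero_add, add_zero, coeffIn, coeffOut, polyIn, polyOut, e1, e2,
    crossProd_insert_left htS, crossProd_insert_right htR, ratioProd_insert htS,
    ratioProd_insert htR, prod_insert htS, prod_insert htR, sub_self, zero_sub, zero_add, hs.neg,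
    card_insert_of_notMem htS, card_insert_of_notMem ht₀]
  have hk : #S ≤ #T₀ := card_le_card hST
  have hR : ∀ v ∈ T₀ \ S, s (x t - x v) ≠ 0 := fun v hv =>
    hxx t ht v (mem_insert_of_mem (sdiff_subset hv)) fun h => htR (h ▸ hv)
  have hS' : ∀ v ∈ S, s (x t - x v) ≠ 0 := fun v hv =>
    hxx t ht v (mem_insert_of_mem (hST hv)) fun h => htS (h ▸ hv)
  have f1 := hs.prod_div_mul_prod (h := h) hR
  have f2 := prod_div_mul_prod (h := h) hS'
  have g1 := hxg #S (by rw [card_insert_of_notMem ht₀]; omega)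
  have g2 := hxg (#S + 1) (by rw [card_insert_of_notMem ht₀]; omega)
  have p1 := prod_erase_range (s := s) (h := h) g (x t) (m := #T₀ + 1) (k := #S) (by omega)
  have p2 := prod_erase_range (s := s) (h := h) g (x t) (m := #T₀ + 1) (k := #S + 1) (by omega)
  rw [mul_comm, ← eq_div_iff g1] at p1
  rw [mul_comm, ← eq_div_iff g2] at p2
  rw [p1, p2, ← f1, ← f2]
  push_cast at g2 ⊢
  rw [add_sub_cancel_right]
  field_simp
  ring

/-- The common factors over i' ≠ #S kill every S with #S ≠ i. For #S = i the parts without and with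
the new variable cancel by `IsSigma.jacksonWeight_succ`. -/
lemma jacksonDefect_eq_zero_of_le (hs : IsSigma s) {b c d f g : ℂ} (hg : g = b + c + d + f)
    (hxg : ∀ u ∈ T, ∀ i ≤ #T, s (x u + (g + (i : ℂ) * h)) ≠ 0) {i : ℕ} (hi : i ≤ #T) :
    jacksonDefect s h x b c d f g T (-(g + i * h)) = 0 := by
  have hmem : i ∈ range (#T + 1) := by simpa [Nat.lt_succ_iff] using hi
  have hden : polyDen s h x g T (-(g + i * h)) = 0 := by
    rw [polyDen, prod_eq_zero hmem (by rw [neg_add_cancel, hs.zero]), mul_zero]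
  rw [jacksonDefect, hden, mul_zero, mul_zero, sub_zero]
  refine sum_eq_zero fun S hS => ?_
  have hST := mem_powerset.mp hS
  have hk : #S ≤ #T := card_le_card hST
  by_cases hSi : #S = i
  · subst hSi
    have r1 : ratioProd s x d (g + f + #T * h) (g + ((#S : ℂ) - 1) * h) S *
        ∏ u ∈ S, s (-(g + #S * h) - x u + h) =
        ∏ u ∈ S, -(s (x u + d) * s (x u + (g + f + #T * h))) := by
      refine ratioProd_mul_prod (φ := fun u => -(g + #S * h) - x u + h) (fun u hu => ?_)
        fun u _ => ?_
      -- As u ∈ S, the natural number #S - 1 is not truncated; in `r4`, u ∈ T \ S likewise keeps #S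
      -- + 1 ≤ #T.
      · have h1 : 0 < #S := card_pos.mpr ⟨u, hu⟩
        have := hxg u (hST hu) (#S - 1) (by omega)
        rwa [Nat.cast_pred h1] at this
      · rw [← hs.neg]; ring_nf
    have r2 : ratioProd s x (g - b) (g - c) (g + #S * h) (T \ S) *
        ∏ v ∈ T \ S, s (-(g + #S * h) - x v) =
        ∏ v ∈ T \ S, -(s (x v + (g - b)) * s (x v + (g - c))) := by
      refine ratioProd_mul_prod (φ := fun u => -(g + #S * h) - x u) (fun u hu => ?_)
        fun u _ => ?_
      · exact hxg u (sdiff_subset hu) #S hk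
      · rw [← hs.neg]; ring_nf
    have r3 : ratioProd s x d (g + f + #T * h) (g + #S * h) S *
        ∏ u ∈ S, s (-(g + #S * h) - x u) =
        ∏ u ∈ S, -(s (x u + d) * s (x u + (g + f + #T * h))) := by
      refine ratioProd_mul_prod (φ := fun u => -(g + #S * h) - x u) (fun u hu => ?_)
        fun u _ => ?_
      · exact hxg u (hST hu) #S hk
      · rw [← hs.neg]; ring_nf
    have r4 : ratioProd s x (g - b) (g - c) (g + ((#S : ℂ) + 1) * h) (T \ S) *
        ∏ v ∈ T \ S, s (-(g + #S * h) - x v - h) =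
        ∏ v ∈ T \ S, -(s (x v + (g - b)) * s (x v + (g - c))) := by
      refine ratioProd_mul_prod (φ := fun u => -(g + #S * h) - x u - h) (fun u hu => ?_)
        fun u _ => ?_
      · have h1 : #S < #T := card_lt_card (Finset.ssubset_iff_subset_ne.mpr ⟨hST, by
          rintro rfl; simp at hu⟩)
        have := hxg u (sdiff_subset hu) (#S + 1) h1
        rwa [Nat.cast_succ] at this
      · rw [← hs.neg]; ring_nf
    have w := hs.jacksonWeight_succ (h := h) hk b c f
    have a1 : -(g + #S * h) + (g - b) = -(b + #S * h) := by ring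
    have a2 : -(g + #S * h) + (g - c) = -(c + #S * h) := by ring
    have a3 : -(g + #S * h) + d = -(b + c + f + #S * h) := by rw [hg]; ring
    have a4 : -(g + #S * h) + (g + f + #T * h) = f + ((#T - #S : ℕ) : ℂ) * h := by
      rw [Nat.cast_sub hk]; ring
    rw [coeffIn, coeffOut, polyIn, polyOut, a1, a2, a3, a4]
    generalize ∏ j ∈ (range (#T + 1)).erase #S, s (-(g + #S * h) + (g + j * h)) = e
    linear_combination (crossProd s h x S (T \ S) * e *
      (∏ u ∈ S, -(s (x u + d) * s (x u + (g + f + #T * h)))) *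
      (∏ v ∈ T \ S, -(s (x v + (g - b)) * s (x v + (g - c))))) * w +
      crossProd s h x S (T \ S) * e * jacksonWeight s h b c f (#T + 1) #S *
        (s (-(b + #S * h)) * s (-(c + #S * h))) *
        (ratioProd s x (g - b) (g - c) (g + #S * h) (T \ S) *
          (∏ v ∈ T \ S, s (-(g + #S * h) - x v)) * r1 +
          (∏ u ∈ S, -(s (x u + d) * s (x u + (g + f + #T * h)))) * r2) +
      crossProd s h x S (T \ S) * e * jacksonWeight s h b c f (#T + 1) (#S + 1) *
        (s (-(b + c + f + #S * h)) * s (f + ((#T - #S : ℕ) : ℂ) * h)) *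
        (ratioProd s x (g - b) (g - c) (g + ((#S : ℂ) + 1) * h) (T \ S) *
          (∏ v ∈ T \ S, s (-(g + #S * h) - x v - h)) * r3 +
          (∏ u ∈ S, -(s (x u + d) * s (x u + (g + f + #T * h)))) * r4)
  · have h0 : ∏ j ∈ (range (#T + 1)).erase #S, s (-(g + i * h) + (g + j * h)) = 0 :=
      prod_eq_zero (mem_erase.mpr ⟨Ne.symm hSi, hmem⟩) (by rw [neg_add_cancel, hs.zero])
    rw [polyIn, polyOut, h0]
    ring

/-- At y = -d all terms with the new variable vanish. The others form the Jackson sum over T with d,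
f replaced by d - h, f + h, which leaves g and d + f unchanged. -/
lemma jacksonDefect_neg (hs : IsSigma s) {b c d f g : ℂ} (hg : g = b + c + d + f)
    (ih : ∑ S ∈ T.powerset, jacksonTerm s h x b c (d - h) (f + h) g T S =
      rise s h (b + (f + h)) #T * rise s h (c + (f + h)) #T *
        ∏ u ∈ T, s (x u + ((d - h) + (f + h)))) :
    jacksonDefect s h x b c d f g T (-d) = 0 := by
  have key : ∀ S ∈ T.powerset, coeffOut s h x b c d f g T S * polyOut s h x b c g T S (-d) +
      coeffIn s h x b c d f g T S * polyIn s h x d f g T S (-d) =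
      jacksonTerm s h x b c (d - h) (f + h) g T S *
        (s f * (s (c + f) * s (b + f)) * polyDen s h x g T (-d)) := by
    intro S hS
    have hST := mem_powerset.mp hS
    have hk : #S ≤ #T := card_le_card hST
    have h1 : polyIn s h x d f g T S (-d) = 0 := by
      rw [polyIn, neg_add_cancel, hs.zero]; ring
    have h2 : ratioProd s x d (g + f + #T * h) (g + ((#S : ℂ) - 1) * h) S *
        ∏ u ∈ S, s (-d - x u + h) =
        ratioProd s x (d - h) (g + f + #T * h) (g + ((#S : ℂ) - 1) * h) S *
        ∏ u ∈ S, s (-d - x u) := by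
      rw [ratioProd, ratioProd, ← prod_mul_distrib, ← prod_mul_distrib]
      refine prod_congr rfl fun u _ => ?_
      rw [show -d - x u + h = -(x u + (d - h)) by ring, show -d - x u = -(x u + d) by ring,
        hs.neg, hs.neg]
      ring
    have h3 : (∏ u ∈ T \ S, s (-d - x u)) * ∏ u ∈ S, s (-d - x u) = ∏ u ∈ T, s (-d - x u) :=
      prod_sdiff hST
    have h4 := prod_erase_range (s := s) (h := h) g (-d) hk
    have a1 : -d + (g - b) = c + f := by rw [hg]; ring
    have a2 : -d + (g - c) = b + f := by rw [hg]; ring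
    have a3 : -d + (g + #S * h) = b + c + f + #S * h := by rw [hg]; ring
    have a4 : g + (f + h) + ((#T : ℂ) - 1) * h = g + f + #T * h := by ring
    rw [h1, mul_zero, add_zero, coeffOut, polyOut, jacksonTerm, polyDen, a1, a2, a4, ← h3, ← h4, a3,
      jacksonWeight_succ_left hk]
    generalize ∏ j ∈ (range (#T + 1)).erase #S, s (-d + (g + j * h)) = e
    linear_combination (crossProd s h x S (T \ S) * e * (s (c + f) * s (b + f)) *
      ratioProd s x (g - b) (g - c) (g + #S * h) (T \ S) * (∏ v ∈ T \ S, s (-d - x v)) *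
      (s (b + c + f + #S * h) * s f * jacksonWeight s h b c (f + h) #T #S)) * h2
  rw [jacksonDefect, sum_congr rfl key, ← sum_mul, ih, rise_succ', rise_succ',
    show -d + (d + f) = f by ring]
  simp only [show d - h + (f + h) = d + f by ring, add_assoc]
  ring

end Zeros

/-! ### The Jackson summation over subsets -/

section Jackson

variable {ι : Type*} [DecidableEq ι] {s : ℂ → ℂ} {h : ℂ} {x : ι → ℂ} {T : Finset ι}

/-- Splitting the subsets of `insert t T` by whether they contain t, and clearing denominators,
shows that the sum for `insert t T` is governed by `jacksonDefect` at y = x t. -/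
lemma sum_jacksonTerm_insert (hs : IsSigma s) {t : ι} (ht : t ∉ T) (b c d f g : ℂ)
    (hxx : ∀ u ∈ T, s (x t - x u) ≠ 0) (hxg : ∀ i ≤ #T, s (x t + (g + (i : ℂ) * h)) ≠ 0) :
    (∑ S ∈ (insert t T).powerset, jacksonTerm s h x b c d f g (insert t T) S) *
      polyDen s h x g T (x t) =
    ∑ S ∈ T.powerset, (coeffOut s h x b c d f g T S * polyOut s h x b c g T S (x t) +
      coeffIn s h x b c d f g T S * polyIn s h x d f g T S (x t)) := by
  rw [sum_powerset_insert ht, ← sum_add_distrib, sum_mul]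
  refine sum_congr rfl fun S hS => ?_
  have hST := mem_powerset.mp hS
  have htS : t ∉ S := fun h => ht (hST h)
  have htR : t ∉ T \ S := fun h => ht (sdiff_subset h)
  have e1 : insert t T \ S = insert t (T \ S) := insert_sdiff_of_notMem _ htS
  have e2 : insert t T \ insert t S = T \ S := by
    rw [insert_sdiff_insert, sdiff_insert_of_notMem ht]
  have hk : #S ≤ #T := card_le_card hST
  have f1 := hs.prod_div_mul_prod (h := h) (R := T \ S) fun v hv => hxx v (sdiff_subset hv)
  have f2 := prod_div_mul_prod (h := h) (S := S) fun v hv => hxx v (hST hv)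
  have f3 : (∏ u ∈ T \ S, s (x t - x u)) * ∏ u ∈ S, s (x t - x u) = ∏ u ∈ T, s (x t - x u) :=
    prod_sdiff hST
  have g1 := hxg #S hk
  have p1 := prod_erase_range (s := s) (h := h) g (x t) hk
  rw [jacksonTerm, jacksonTerm, coeffIn, coeffOut, polyIn, polyOut, polyDen, e1, e2,
    crossProd_insert_left htS, crossProd_insert_right htR, ratioProd_insert htS,
    ratioProd_insert htR, card_insert_of_notMem htS, card_insert_of_notMem ht, ← f1, ← f2, ← f3,
    ← p1]
  push_cast
  simp only [add_sub_cancel_right]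
  generalize s (x t + (g + (#S : ℂ) * h)) = e at g1
  field_simp

/-- The 2#T + 2 nodes are -d, the x u, and the -(g + ih) with i ≤ #T. Their sum exceeds the sum of
zeros of the space by exactly f, hence the hypothesis s f ≠ 0; the other conditions keep the nodes
apart from each other and from x t. -/
lemma sum_jacksonTerm_of_generic (hs : IsSigma s) {t : ι} (ht : t ∉ T) {b c d f g : ℂ}
    (hg : g = b + c + d + f)
    (hxx : ∀ u ∈ insert t T, ∀ v ∈ insert t T, u ≠ v → s (x u - x v) ≠ 0)
    (hxg : ∀ u ∈ insert t T, ∀ i ≤ #T, s (x u + (g + (i : ℂ) * h)) ≠ 0)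
    (hh : ∀ i, 0 < i → i ≤ #T → s ((i : ℂ) * h) ≠ 0)
    (hf : s f ≠ 0) (hd : ∀ u ∈ insert t T, s (x u + d) ≠ 0)
    (hbc : ∀ i ≤ #T, s (b + c + f + (i : ℂ) * h) ≠ 0)
    (ih : ∑ S ∈ T.powerset, jacksonTerm s h x b c (d - h) (f + h) g T S =
      rise s h (b + (f + h)) #T * rise s h (c + (f + h)) #T *
        ∏ u ∈ T, s (x u + ((d - h) + (f + h)))) :
    ∑ S ∈ (insert t T).powerset, jacksonTerm s h x b c d f g (insert t T) S =
      rise s h (b + f) #(insert t T) * rise s h (c + f) #(insert t T) *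
        ∏ u ∈ insert t T, s (x u + (d + f)) := by
  have hneg : ∀ {u}, s u ≠ 0 → s (-u) ≠ 0 := fun h => by rw [hs.neg]; exact neg_ne_zero.mpr h
  have hxtT : ∀ u ∈ T, s (x t - x u) ≠ 0 := fun u hu =>
    hxx t (mem_insert_self t T) u (mem_insert_of_mem hu) fun h => ht (h ▸ hu)
  have hnode : ∀ i j : ℕ, i ≤ #T → j < i → s ((i : ℂ) * h - j * h) ≠ 0 := fun i j hi hj => by
    have := hh (i - j) (by omega) (by omega)
    rwa [Nat.cast_sub hj.le, sub_mul] at this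
  let a : Option (ι ⊕ ℕ) → ℂ := fun o => o.elim (-d) (Sum.elim x fun i => -(g + (i : ℂ) * h))
  have hD : jacksonDefect s h x b c d f g T (x t) = 0 := by
    refine hs.eq_zero_of_mem_thetaSpace (I := insertNone (T.disjSum (range (#T + 1)))) (a := a)
      (β := ∑ u ∈ T, x u - d - f - ∑ i ∈ range (#T + 1), (g + (i : ℂ) * h)) ?_ ?_ ?_ ?_ ?_
    · simpa using jacksonDefect_mem hg T
    · rintro (_ | u | i) hu (_ | v | j) hv huv <;>
        simp only [mem_insertNone, Option.mem_def, Option.some.injEq, forall_eq', inl_mem_disjSum,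
          inr_mem_disjSum, mem_range, Nat.lt_succ_iff, ne_eq, not_true_eq_false, Sum.inl.injEq,
          Sum.inr.injEq, a, Option.elim, Sum.elim_inl, Sum.elim_inr] at hu hv huv ⊢
      · convert hneg (hd v (mem_insert_of_mem hv)) using 2; ring_nf
      · convert hbc j hv using 2; rw [hg]; ring_nf
      · convert hd u (mem_insert_of_mem hu) using 2; ring_nf
      · exact hxx u (mem_insert_of_mem hu) v (mem_insert_of_mem hv) huv
      · convert hxg u (mem_insert_of_mem hu) j hv using 2; ring_nf
      · convert hneg (hbc i hu) using 2; rw [hg]; ring_nf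
      · convert hneg (hxg v (mem_insert_of_mem hv) i hu) using 2; ring_nf
      · rcases lt_or_gt_of_ne huv with hij | hij
        · convert hnode j i hv hij using 2; ring_nf
        · convert hneg (hnode i j hu hij) using 2; ring_nf
    · rw [sum_insertNone, sum_disjSum]
      simp only [a, Option.elim, Sum.elim_inl, Sum.elim_inr]
      rw [sum_neg_distrib]
      convert hf using 2
      ring
    · rintro (_ | u | i) hu <;>
        simp only [mem_insertNone, Option.mem_def, Option.some.injEq, forall_eq', inl_mem_disjSum,
          inr_mem_disjSum, mem_range, Nat.lt_succ_iff, a, Option.elim, Sum.elim_inl,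
          Sum.elim_inr] at hu ⊢
      · exact jacksonDefect_neg hs hg ih
      · exact jacksonDefect_eq_zero_of_mem hs hu (fun u hu v hv => hxx u (mem_insert_of_mem hu) v
          (mem_insert_of_mem hv)) (hxg u (mem_insert_of_mem hu))
      · exact jacksonDefect_eq_zero_of_le hs hg (fun u hu => hxg u (mem_insert_of_mem hu)) hu
    · rintro (_ | u | i) hu <;>
        simp only [mem_insertNone, Option.mem_def, Option.some.injEq, forall_eq', inl_mem_disjSum,
          inr_mem_disjSum, mem_range, Nat.lt_succ_iff, a, Option.elim, Sum.elim_inl,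
          Sum.elim_inr] at hu ⊢
      · convert hd t (mem_insert_self t T) using 2; ring_nf
      · exact hxtT u hu
      · convert hxg t (mem_insert_self t T) i hu using 2; ring_nf
  have hden : polyDen s h x g T (x t) ≠ 0 :=
    mul_ne_zero (prod_ne_zero_iff.mpr hxtT) (prod_ne_zero_iff.mpr fun i hi =>
      hxg t (mem_insert_self t T) i (by simpa [Nat.lt_succ_iff] using hi))
  apply mul_right_cancel₀ hden
  rw [sum_jacksonTerm_insert hs ht b c d f g hxtT (hxg t (mem_insert_self t T)), prod_insert ht,
    card_insert_of_notMem ht]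
  rw [jacksonDefect, sub_eq_zero] at hD
  rw [hD]
  ring

/-- The elliptic Jackson summation of type `A`, as a sum over the subsets of a finite set. -/
theorem IsSigma.sum_jacksonTerm (hs : IsSigma s) (T : Finset ι) : ∀ (b c d f g : ℂ),
    g = b + c + d + f → (∀ u ∈ T, ∀ v ∈ T, u ≠ v → s (x u - x v) ≠ 0) →
    (∀ u ∈ T, ∀ i < #T, s (x u + (g + (i : ℂ) * h)) ≠ 0) →
    (∀ i, 0 < i → i < #T → s ((i : ℂ) * h) ≠ 0) →
    ∑ S ∈ T.powerset, jacksonTerm s h x b c d f g T S =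
      rise s h (b + f) #T * rise s h (c + f) #T * ∏ u ∈ T, s (x u + (d + f)) := by
  induction T using Finset.induction_on with
  | empty => intros; simp [jacksonTerm, crossProd, ratioProd, jacksonWeight, rise]
  | insert t T ht ih =>
    intro b c d f g hg hxx hxg hh
    have hcard : #(insert t T) = #T + 1 := card_insert_of_notMem ht
    -- The deformation d - τ, f + τ fixes g and d + f. No denominator involves d or f separately, so
    -- both sides are continuous in τ.
    have := eq_zero_of_countable (f := fun τ =>
      ∑ S ∈ (insert t T).powerset, jacksonTerm s h x b c (d - τ) (f + τ) g (insert t T) S -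
        rise s h (b + (f + τ)) #(insert t T) * rise s h (c + (f + τ)) #(insert t T) *
        ∏ u ∈ insert t T, s (x u + (d - τ + (f + τ))))
      (Z := {τ | s (f + τ) = 0} ∪ (⋃ u ∈ insert t T, {τ | s (x u + d - τ) = 0}) ∪
        ⋃ i : ℕ, {τ | s (b + c + f + i * h + τ) = 0}) ?_ ?_ ?_ 0
    · simpa [sub_eq_zero] using this
    · have := hs.continuous
      unfold jacksonTerm crossProd ratioProd jacksonWeight rise
      fun_prop
    · refine ((hs.countable_add f).union (Set.Countable.biUnion (Finset.countable_toSet _)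
        fun u _ => hs.countable_sub _)).union (Set.countable_iUnion fun i => hs.countable_add _)
    · intro τ hτ
      simp only [Set.mem_union, Set.mem_iUnion, Set.mem_ofPred_eq, not_or, not_exists] at hτ
      obtain ⟨⟨h1, h2⟩, h3⟩ := hτ
      refine sub_eq_zero.mpr (sum_jacksonTerm_of_generic hs ht (by rw [hg]; ring) hxx
        (fun u hu i hi => hxg u hu i (by omega)) (fun i h0 hi => hh i h0 (by omega)) h1
        (fun u hu => ?_) (fun i _ => ?_) (ih b c _ _ g (by rw [hg]; ring) ?_ ?_ ?_))
      · have := h2 u hu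
        rwa [add_sub_assoc] at this
      · convert h3 i using 2; ring_nf
      · exact fun u hu v hv => hxx u (mem_insert_of_mem hu) v (mem_insert_of_mem hv)
      · exact fun u hu i hi => hxg u (mem_insert_of_mem hu) i (by omega)
      · exact fun i h0 hi => hh i h0 (by omega)

end Jackson

/-! ### From the odd function back to theta -/

section Gauge

variable {ι : Type*} {s s' : ℂ → ℂ} {h : ℂ} {x : ι → ℂ}

lemma rise_gauge (hss : ∀ u, s' u = Complex.exp (u / 2) * s u) (u : ℂ) (k : ℕ) :
    rise s' h u k = Complex.exp ((k * u + h * (k * (k - 1)) / 2) / 2) * rise s h u k := by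
  induction k with
  | zero => simp [rise]
  | succ k ih =>
    rw [rise_succ, rise_succ, ih, hss, mul_mul_mul_comm, ← Complex.exp_add]
    congr 2
    push_cast
    ring

lemma crossProd_gauge (hss : ∀ u, s' u = Complex.exp (u / 2) * s u) (S R : Finset ι) :
    crossProd s' h x S R = Complex.exp (#S * #R * h / 2) * crossProd s h x S R := by
  have : ∀ u v, s' (x v - x u + h) / s' (x v - x u) =
      Complex.exp (h / 2) * (s (x v - x u + h) / s (x v - x u)) := by
    intro u v
    rw [hss, hss, mul_div_mul_comm, ← Complex.exp_sub]
    congr 2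
    ring
  simp only [crossProd, this, prod_mul_distrib, prod_const, ← Complex.exp_nat_mul]
  congr 2
  ring

lemma ratioProd_gauge (hss : ∀ u, s' u = Complex.exp (u / 2) * s u) (α β γ : ℂ) (S : Finset ι) :
    ratioProd s' x α β γ S =
      Complex.exp ((∑ u ∈ S, x u + #S * (α + β - γ)) / 2) * ratioProd s x α β γ S := by
  have : ∀ u, s' (x u + α) * s' (x u + β) / s' (x u + γ) =
      Complex.exp ((x u + (α + β - γ)) / 2) * (s (x u + α) * s (x u + β) / s (x u + γ)) := by
    intro u
    rw [hss, hss, hss, mul_mul_mul_comm, mul_div_mul_comm, ← Complex.exp_add, ← Complex.exp_sub]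
    congr 2
    ring
  simp only [ratioProd, this, prod_mul_distrib, ← Complex.exp_sum]
  rw [← sum_div, sum_add_distrib, sum_const, nsmul_eq_mul]

variable [DecidableEq ι]

/-- Under the balancing condition all exponential factors combine into a constant independent of S,
apart from exp(f #S). This is the origin of the powers of F = aq/(ρ₁ρ₂) in the theorem. -/
lemma jacksonTerm_gauge (hss : ∀ u, s' u = Complex.exp (u / 2) * s u) {b c d f g : ℂ}
    (hg : g = b + c + d + f) {T S : Finset ι} (hS : S ⊆ T) :
    Complex.exp (f * #S) * jacksonTerm s' h x b c d f g T S =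
      Complex.exp ((∑ u ∈ T, x u + #T * (b + c + d + 3 * f) + h * (#T * (#T - 1))) / 2) *
        jacksonTerm s h x b c d f g T S := by
  have hk : #S ≤ #T := card_le_card hS
  have hc : (#(T \ S) : ℂ) = #T - #S := by rw [card_sdiff_of_subset hS, Nat.cast_sub hk]
  have hsum : ∑ u ∈ T \ S, x u = ∑ u ∈ T, x u - ∑ u ∈ S, x u :=
    eq_sub_of_add_eq (sum_sdiff hS)
  rw [jacksonTerm, jacksonTerm, jacksonWeight, jacksonWeight, crossProd_gauge hss,
    ratioProd_gauge hss, ratioProd_gauge hss, rise_gauge hss, rise_gauge hss, rise_gauge hss,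
    rise_gauge hss, hc, hsum, Nat.cast_sub hk]
  have hexp : ∀ e0 e1 e2 e3 e4 e5 e6 e7 e8 : ℂ, e0 + (e1 + e2 + e3 + (e4 + e5 + e6 + e7)) = e8 →
      ∀ A B C D E F G, Complex.exp e0 * (Complex.exp e1 * A * (Complex.exp e2 * B) *
        (Complex.exp e3 * C) * (Complex.exp e4 * D * (Complex.exp e5 * E) * (Complex.exp e6 * F) *
        (Complex.exp e7 * G))) = Complex.exp e8 * (A * B * C * (D * E * F * G)) := by
    rintro e0 e1 e2 e3 e4 e5 e6 e7 _ rfl A B C D E F G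
    simp only [Complex.exp_add]
    ring
  apply hexp
  rw [hg]
  ring

theorem sum_exp_mul_jacksonTerm (hs : IsSigma s) (hss : ∀ u, s' u = Complex.exp (u / 2) * s u)
    (T : Finset ι) {b c d f g : ℂ} (hg : g = b + c + d + f)
    (hxx : ∀ u ∈ T, ∀ v ∈ T, u ≠ v → s (x u - x v) ≠ 0)
    (hxg : ∀ u ∈ T, ∀ i < #T, s (x u + (g + (i : ℂ) * h)) ≠ 0)
    (hh : ∀ i, 0 < i → i < #T → s ((i : ℂ) * h) ≠ 0) :
    ∑ S ∈ T.powerset, Complex.exp (f * #S) * jacksonTerm s' h x b c d f g T S =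
      rise s' h (b + f) #T * rise s' h (c + f) #T * ∏ u ∈ T, s' (x u + (d + f)) := by
  rw [sum_congr rfl fun S hS => jacksonTerm_gauge hss hg (mem_powerset.mp hS), ← mul_sum,
    hs.sum_jacksonTerm T b c d f g hg hxx hxg hh, rise_gauge hss, rise_gauge hss]
  have : ∏ u ∈ T, s' (x u + (d + f)) =
      Complex.exp ((∑ u ∈ T, x u + #T * (d + f)) / 2) * ∏ u ∈ T, s (x u + (d + f)) := by
    simp only [hss, prod_mul_distrib, ← Complex.exp_sum]
    rw [← sum_div, sum_add_distrib, sum_const, nsmul_eq_mul]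
  rw [this]
  have hexp : ∀ e1 e2 e3 e8 : ℂ, e1 + e2 + e3 = e8 →
      ∀ A B C, Complex.exp e8 * (A * B * C) =
        Complex.exp e1 * A * (Complex.exp e2 * B) * (Complex.exp e3 * C) := by
    rintro e1 e2 e3 _ rfl A B C
    simp only [Complex.exp_add]
    ring
  apply hexp
  ring

end Gauge

/-! ### Subsets of a union of strings -/

section Strings

variable {n : ℕ}

/-- The set of pairs `(r, i)` with `j r ≤ i < k r`. -/
def stringSet (j k : Fin n → ℕ) : Finset (Σ _ : Fin n, ℕ) :=
  univ.sigma fun r => Ico (j r) (k r)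

lemma mem_stringSet {j k : Fin n → ℕ} {u : Σ _ : Fin n, ℕ} :
    u ∈ stringSet j k ↔ j u.1 ≤ u.2 ∧ u.2 < k u.1 := by
  simp [stringSet]

lemma card_stringSet (j k : Fin n → ℕ) : #(stringSet j k) = ∑ r, (k r - j r) := by
  simp [stringSet]

lemma prod_stringSet (j k : Fin n → ℕ) (f : (Σ _ : Fin n, ℕ) → ℂ) :
    ∏ u ∈ stringSet j k, f u = ∏ r, ∏ i ∈ Ico (j r) (k r), f ⟨r, i⟩ :=
  prod_sigma _ _ _

lemma stringSet_mono {j k N : Fin n → ℕ} (h : k ≤ N) : stringSet j k ⊆ stringSet j N := by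
  intro u hu
  rw [mem_stringSet] at *
  exact ⟨hu.1, hu.2.trans_le (h _)⟩

lemma stringSet_sdiff {j k N : Fin n → ℕ} (h : j ≤ k) :
    stringSet j N \ stringSet j k = stringSet k N := by
  ext u
  have : j u.1 ≤ k u.1 := h u.1
  simp only [Finset.mem_sdiff, mem_stringSet]
  omega

/-- A sum over the subsets of a union of strings reduces to a sum over initial segments, if the
terms of the other subsets vanish. -/
lemma sum_powerset_stringSet {j N : Fin n → ℕ} (hjN : j ≤ N)
    (f : Finset (Σ _ : Fin n, ℕ) → ℂ)
    (hf : ∀ S ⊆ stringSet j N, ∀ r i, ⟨r, i⟩ ∈ stringSet j N \ S → ⟨r, i + 1⟩ ∈ S → f S = 0) :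
    ∑ S ∈ (stringSet j N).powerset, f S = ∑ k ∈ Icc j N, f (stringSet j k) := by
  classical
  have hinj : Set.InjOn (stringSet j) (Icc j N : Finset (Fin n → ℕ)) := by
    have key : ∀ k ∈ Icc j N, ∀ k' ∈ Icc j N, stringSet j k = stringSet j k' → k ≤ k' := by
      intro k hk k' hk' hkk' r
      by_contra hlt
      rw [mem_Icc] at hk hk'
      have h1 : (⟨r, k' r⟩ : Σ _ : Fin n, ℕ) ∈ stringSet j k :=
        mem_stringSet.mpr ⟨hk'.1 r, not_le.mp hlt⟩
      rw [hkk', mem_stringSet] at h1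
      exact lt_irrefl _ h1.2
    exact fun k hk k' hk' hkk' => le_antisymm (key k hk k' hk' hkk') (key k' hk' k hk hkk'.symm)
  rw [← sum_image hinj]
  symm
  refine sum_subset (fun S hS => ?_) fun S hS hS' => ?_
  · obtain ⟨k, hk, rfl⟩ := mem_image.mp hS
    exact mem_powerset.mpr (stringSet_mono (mem_Icc.mp hk).2)
  · rw [mem_powerset] at hS
    by_contra hne
    have hdown : ∀ r i, j r ≤ i → ⟨r, i + 1⟩ ∈ S → ⟨r, i⟩ ∈ S := by
      intro r i hi hmem
      by_contra hnot
      refine hne (hf S hS r i (mem_sdiff.mpr ⟨mem_stringSet.mpr ⟨hi, ?_⟩, hnot⟩) hmem)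
      exact (Nat.lt_succ_self i).trans (mem_stringSet.mp (hS hmem)).2
    -- The tuple k is given by the first level at or above j r that is missing from S; level N r
    -- always is.
    have hex : ∀ r, ∃ i, j r ≤ i ∧ ⟨r, i⟩ ∉ S := fun r =>
      ⟨N r, hjN r, fun hmem => lt_irrefl _ (mem_stringSet.mp (hS hmem)).2⟩
    refine hS' (mem_image.mpr ⟨fun r => Nat.find (hex r), ?_, ?_⟩)
    · refine mem_Icc.mpr ⟨fun r => (Nat.find_spec (hex r)).1, fun r => Nat.find_min' (hex r)
        ⟨hjN r, fun hmem => lt_irrefl _ (mem_stringSet.mp (hS hmem)).2⟩⟩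
    · ext ⟨r, i⟩
      rw [mem_stringSet]
      constructor
      · rintro ⟨h1, h2⟩
        by_contra hnot
        exact Nat.find_min (hex r) h2 ⟨h1, hnot⟩
      · intro hmem
        refine ⟨(mem_stringSet.mp (hS hmem)).1, ?_⟩
        by_contra hle
        obtain ⟨t, ht⟩ := Nat.exists_eq_add_of_le (not_lt.mp hle)
        have hspec := Nat.find_spec (hex r)
        have : ∀ t, ⟨r, Nat.find (hex r) + t⟩ ∈ S → ⟨r, Nat.find (hex r)⟩ ∈ S := by
          intro t
          induction t with
          | zero => exact id
          | succ t ih => exact fun h => ih (hdown r _ (hspec.1.trans (Nat.le_add_right _ _)) h)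
        exact hspec.2 (this t (ht ▸ hmem))

end Strings

/-! ### The Jackson summation over a rectangle -/

lemma qpFactorial_natCast (p q a : ℂ) (k : ℕ) :
    qpFactorial p q a k = ∏ i ∈ range k, theta p (a * q ^ i) := rfl

lemma rise_theta_exp {p u v h q : ℂ} (hu : Complex.exp u = v) (hh : Complex.exp h = q) (k : ℕ) :
    rise (fun u => theta p (Complex.exp u)) h u k = qpFactorial p q v k := by
  rw [qpFactorial_natCast, rise]
  refine prod_congr rfl fun i _ => ?_
  rw [Complex.exp_add, Complex.exp_nat_mul, hu, hh]

lemma prod_Ico_div_telescope {φ : ℤ → ℂ} {c : ℤ} {j k : ℕ} (hjk : j ≤ k)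
    (hφ : ∀ i, j ≤ i → i ≤ k → φ (c + 1 - i) ≠ 0) :
    ∏ i ∈ Ico j k, φ (c + 1 - i) / φ (c - i) = φ (c + 1 - j) / φ (c + 1 - k) := by
  induction k, hjk using Nat.le_induction with
  | base => rw [Ico_self, prod_empty, div_self (hφ j le_rfl le_rfl)]
  | succ k hjk ih =>
    have h1 := hφ k hjk (Nat.le_succ k)
    have h2 := hφ (k + 1) (by omega) le_rfl
    have e : c + 1 - ((k + 1 : ℕ) : ℤ) = c - k := by push_cast; ring
    rw [prod_Ico_succ_top hjk, ih fun i hi hik => hφ i hi (hik.trans (Nat.le_succ k)), e]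
    rw [e] at h2
    field_simp

section Rectangular

variable {n : ℕ} (p q : ℂ) (x : Fin n → ℂ)

/-- The products that occur as denominators of the entries of the matrix `B⁽¹⁾`. -/
def bressoudDen (j k : Fin n → ℕ) : ℂ :=
  ∏ r, ∏ s, ∏ i ∈ Ico (j r) (k r), theta p (x r / x s * q ^ ((i : ℤ) + 1 - j s))

/-- The quotient of products of theta functions over the strings from `j` to `k`. -/
def stringRatio (j k : Fin n → ℕ) (α β γ : ℂ) : ℂ :=
  ∏ r, ∏ i ∈ Ico (j r) (k r),
    theta p (α * x r * q ^ i) * theta p (β * x r * q ^ i) / theta p (γ * x r * q ^ i)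

variable {p q x}

/-- The additive coordinates of the points `x r * q ^ i`. -/
def logPoint (h : ℂ) (ξ : Fin n → ℂ) (u : Σ _ : Fin n, ℕ) : ℂ := ξ u.1 + u.2 * h

lemma exp_logPoint_add {h : ℂ} {ξ : Fin n → ℂ} (hh : Complex.exp h = q)
    (hξ : ∀ r, Complex.exp (ξ r) = x r) (r : Fin n) (i : ℕ) (a : ℂ) :
    Complex.exp (logPoint h ξ ⟨r, i⟩ + a) = Complex.exp a * x r * q ^ i := by
  rw [logPoint, Complex.exp_add, Complex.exp_add, Complex.exp_nat_mul, hh, hξ]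
  ring

lemma exp_logPoint_sub {h : ℂ} {ξ : Fin n → ℂ} (hh : Complex.exp h = q)
    (hξ : ∀ r, Complex.exp (ξ r) = x r) (r s : Fin n) (i i' : ℕ) :
    Complex.exp (logPoint h ξ ⟨r, i⟩ - logPoint h ξ ⟨s, i'⟩) =
      x r / x s * q ^ ((i : ℤ) - i') := by
  rw [logPoint, logPoint, show ξ r + i * h - (ξ s + i' * h) =
    (ξ r - ξ s) + (((i : ℤ) - i' : ℤ) : ℂ) * h by push_cast; ring, Complex.exp_add, Complex.exp_sub,
    Complex.exp_int_mul, hh, hξ, hξ]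

lemma ratioProd_stringSet {h : ℂ} {ξ : Fin n → ℂ} (hh : Complex.exp h = q)
    (hξ : ∀ r, Complex.exp (ξ r) = x r) (j k : Fin n → ℕ) {a b c α β γ : ℂ}
    (ha : Complex.exp a = α) (hb : Complex.exp b = β) (hc : Complex.exp c = γ) :
    ratioProd (fun u => theta p (Complex.exp u)) (logPoint h ξ) a b c (stringSet j k) =
      stringRatio p q x j k α β γ := by
  simp only [ratioProd, prod_stringSet, exp_logPoint_add hh hξ, ha, hb, hc, stringRatio]

/-- Along the string of s the factors θ(z q^(i'-i+1)) / θ(z q^(i'-i)) telescope in i, so only the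
end points j s and k s remain. -/
lemma crossProd_stringSet (hq : q ≠ 0) {h : ℂ} {ξ : Fin n → ℂ} (hh : Complex.exp h = q)
    (hξ : ∀ r, Complex.exp (ξ r) = x r) {j k N : Fin n → ℕ} (hjk : j ≤ k)
    (hΘ : ∀ r s (e : ℤ), (r ≠ s ∨ 0 < e) → theta p (x r / x s * q ^ e) ≠ 0) :
    crossProd (fun u => theta p (Complex.exp u)) h (logPoint h ξ) (stringSet j k) (stringSet k N) =
      (∏ r, ∏ s, ∏ i ∈ Ico (k r) (N r), theta p (x r / x s * q ^ ((i : ℤ) + 1 - j s))) /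
        bressoudDen p q x k N := by
  simp only [crossProd, prod_stringSet, bressoudDen, ← prod_div_distrib]
  have : ∀ s : Fin n, ∏ i ∈ Ico (j s) (k s), ∏ r, ∏ i' ∈ Ico (k r) (N r),
      theta p (Complex.exp (logPoint h ξ ⟨r, i'⟩ - logPoint h ξ ⟨s, i⟩ + h)) /
        theta p (Complex.exp (logPoint h ξ ⟨r, i'⟩ - logPoint h ξ ⟨s, i⟩)) =
      ∏ r, ∏ i' ∈ Ico (k r) (N r), theta p (x r / x s * q ^ ((i' : ℤ) + 1 - j s)) /
        theta p (x r / x s * q ^ ((i' : ℤ) + 1 - k s)) := by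
    intro s
    rw [Finset.prod_comm]
    refine prod_congr rfl fun r _ => ?_
    rw [Finset.prod_comm]
    refine prod_congr rfl fun i' hi' => ?_
    rw [← prod_Ico_div_telescope (φ := fun e => theta p (x r / x s * q ^ e)) (hjk s)]
    · refine prod_congr rfl fun i _ => ?_
      rw [Complex.exp_add, exp_logPoint_sub hh hξ, hh, add_sub_right_comm, zpow_add_one₀ hq, mul_assoc]
    · intro i _ hi
      refine hΘ r s _ ?_
      rcases eq_or_ne r s with rfl | hrs
      · have := (mem_Ico.mp hi').1
        exact Or.inr (by omega)
      · exact Or.inl hrs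
  rw [prod_congr rfl fun s _ => this s, Finset.prod_comm]

/-- The elliptic Jackson summation of type `A`, as a sum over a rectangle. -/
theorem sum_Icc_theta (hp : ‖p‖ < 1) (hq : q ≠ 0) (hx : ∀ r, x r ≠ 0) {j N : Fin n → ℕ}
    (hjN : j ≤ N) {A B C D F : ℂ} (hB : B ≠ 0) (hC : C ≠ 0) (hD : D ≠ 0) (hF : F ≠ 0)
    (hA : A * q = B * C * D * F)
    (hΘ : ∀ r s (e : ℤ), (r ≠ s ∨ 0 < e) → theta p (x r / x s * q ^ e) ≠ 0)
    (hAx : ∀ r (e : ℕ), theta p (A * x r * q ^ (j r + (e + 1))) ≠ 0)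
    {m : ℕ} (hm : m = ∑ r, (N r - j r)) :
    ∑ k ∈ Icc j N, F ^ (∑ r, (k r - j r)) *
      ((∏ r, ∏ s, ∏ i ∈ Ico (k r) (N r), theta p (x r / x s * q ^ ((i : ℤ) + 1 - j s))) /
        bressoudDen p q x k N *
      stringRatio p q x j k D (A * F * q ^ m) (A * q ^ (∑ r, (k r - j r))) *
      stringRatio p q x k N (C * D * F) (B * D * F) (A * q ^ (∑ r, (k r - j r) + 1)) *
      (qpFactorial p q B (∑ r, (k r - j r) : ℕ) * qpFactorial p q C (∑ r, (k r - j r) : ℕ) *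
        qpFactorial p q (B * C * F * q ^ (∑ r, (k r - j r))) (m - ∑ r, (k r - j r) : ℕ) *
        qpFactorial p q F (m - ∑ r, (k r - j r) : ℕ))) =
    qpFactorial p q (B * F) m * qpFactorial p q (C * F) m *
      ∏ r, ∏ i ∈ Ico (j r) (N r), theta p (D * F * x r * q ^ i) := by
  have eB := Complex.exp_log hB
  have eC := Complex.exp_log hC
  have eD := Complex.exp_log hD
  have eF := Complex.exp_log hF
  have hh := Complex.exp_log hq
  obtain ⟨ξ, hξ⟩ : ∃ ξ : Fin n → ℂ, ∀ r, Complex.exp (ξ r) = x r :=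
    ⟨fun r => Complex.log (x r), fun r => Complex.exp_log (hx r)⟩
  set b := Complex.log B
  set c := Complex.log C
  set d := Complex.log D
  set f := Complex.log F
  set h := Complex.log q
  have hs := isSigma_sigmaFn hp
  have hne : ∀ {u}, theta p (Complex.exp u) ≠ 0 → sigmaFn p u ≠ 0 := fun h h0 => h (by
    rw [theta_exp, h0, mul_zero])
  have eg : Complex.exp (b + c + d + f) = A * q := by
    rw [Complex.exp_add, Complex.exp_add, Complex.exp_add, eB, eC, eD, eF, hA]
  have hcard : #(stringSet j N) = m := by rw [card_stringSet, hm]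
  -- Taking g to be the sum b + c + d + f of logarithms makes the balancing condition exact, not
  -- merely true modulo 2πi, and exp g = Aq.
  have main := sum_exp_mul_jacksonTerm (s' := fun u => theta p (Complex.exp u)) (x := logPoint h ξ)
    (h := h) hs (theta_exp p) (stringSet j N) (b := b) (c := c) (d := d) (f := f) rfl ?_ ?_ ?_
  · rw [sum_powerset_stringSet hjN, hcard, rise_theta_exp (by rw [Complex.exp_add, eB, eF]) hh,
      rise_theta_exp (by rw [Complex.exp_add, eC, eF]) hh, prod_stringSet] at main
    · simp only [exp_logPoint_add hh hξ, Complex.exp_add d f, eD, eF] at main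
      rw [← main]
      refine sum_congr rfl fun k hk => ?_
      have hjk := (mem_Icc.mp hk).1
      have e1 : Complex.exp (b + c + d + f + f + ((m : ℂ) - 1) * h) = A * F * q ^ m := by
        rw [sub_mul, Complex.exp_add, Complex.exp_add, eg, eF, Complex.exp_sub, Complex.exp_nat_mul,
          one_mul, hh]
        field_simp
      have e2 : ∀ l : ℕ, Complex.exp (b + c + d + f + ((l : ℂ) - 1) * h) = A * q ^ l := fun l => by
        rw [sub_mul, Complex.exp_add, eg, Complex.exp_sub, Complex.exp_nat_mul, one_mul, hh]
        field_simp
      have e3 : ∀ l : ℕ, Complex.exp (b + c + d + f + (l : ℂ) * h) = A * q ^ (l + 1) := fun l => by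
        rw [Complex.exp_add, eg, Complex.exp_nat_mul, hh]
        ring
      have e4 : Complex.exp (b + c + d + f - b) = C * D * F := by
        rw [show b + c + d + f - b = c + d + f by ring, Complex.exp_add, Complex.exp_add, eC, eD, eF]
      have e5 : Complex.exp (b + c + d + f - c) = B * D * F := by
        rw [show b + c + d + f - c = b + d + f by ring, Complex.exp_add, Complex.exp_add, eB, eD, eF]
      have e6 : ∀ l : ℕ, Complex.exp (b + c + f + l * h) = B * C * F * q ^ l := fun l => by
        rw [Complex.exp_add, Complex.exp_add, Complex.exp_add, Complex.exp_nat_mul, eB, eC, eF, hh]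
      rw [jacksonTerm, jacksonWeight, stringSet_sdiff hjk, crossProd_stringSet hq hh hξ hjk hΘ, hcard,
        ratioProd_stringSet hh hξ j k eD e1 (e2 _), ratioProd_stringSet hh hξ k N e4 e5 (e3 _),
        rise_theta_exp eB hh, rise_theta_exp eC hh, rise_theta_exp (e6 _) hh, rise_theta_exp eF hh,
        mul_comm f, Complex.exp_nat_mul, eF, card_stringSet]
    -- If (r, i + 1) lies in S and (r, i) does not, their cross factor has numerator θ(1) = 0.
    · intro S _ r i hi hi'
      have h0 : theta p 1 = 0 := by
        have := theta_exp p 0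
        rwa [hs.zero, mul_zero, Complex.exp_zero] at this
      have : crossProd (fun u => theta p (Complex.exp u)) h (logPoint h ξ) S (stringSet j N \ S) = 0 := by
        refine prod_eq_zero hi' (prod_eq_zero hi ?_)
        have e : logPoint h ξ ⟨r, i⟩ - logPoint h ξ ⟨r, i + 1⟩ + h = 0 := by
          simp only [logPoint]; push_cast; ring
        simp only [e, Complex.exp_zero, h0, zero_div]
      rw [jacksonTerm, this]
      ring
  · rintro ⟨r, i⟩ _ ⟨s, i'⟩ _ huv
    rcases eq_or_ne r s with rfl | hrs
    · rcases lt_trichotomy i i' with hlt | rfl | hlt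
      · rw [hs.sub_comm]
        refine neg_ne_zero.mpr (hne ?_)
        rw [exp_logPoint_sub hh hξ]
        exact hΘ _ _ _ (Or.inr (by omega))
      · exact absurd rfl huv
      · refine hne ?_
        rw [exp_logPoint_sub hh hξ]
        exact hΘ _ _ _ (Or.inr (by omega))
    · refine hne ?_
      rw [exp_logPoint_sub hh hξ]
      exact hΘ _ _ _ (Or.inl hrs)
  · rintro ⟨r, i⟩ hu e _
    obtain ⟨t, rfl⟩ : ∃ t, i = j r + t := Nat.exists_eq_add_of_le (mem_stringSet.mp hu).1
    refine hne ?_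
    rw [exp_logPoint_add hh hξ, Complex.exp_add, eg, Complex.exp_nat_mul, hh]
    convert hAx r (t + e) using 2
    ring
  · intro e h0 he
    -- θ(q^e) ≠ 0 is only known through x r / x r, so some index r is needed; the string set is
    -- non-empty here.
    obtain ⟨⟨r, i⟩, _⟩ := card_pos.mp (h0.trans he)
    refine hne ?_
    have := hΘ r r e (Or.inr (by exact_mod_cast h0))
    rw [div_self (hx r), one_mul, zpow_natCast] at this
    rwa [Complex.exp_nat_mul, hh]

end Rectangular

/-! ### Shifted factorials and the matrix entries -/

lemma qpFactorial_add_eq_mul_prod_Ico (p q a : ℂ) {j k : ℕ} (hjk : j ≤ k) (M : ℕ) :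
    qpFactorial p q a (k + M : ℕ) =
      qpFactorial p q a (j + M : ℕ) * ∏ i ∈ Ico j k, theta p (a * q ^ (i + M)) := by
  rw [qpFactorial_natCast, qpFactorial_natCast, prod_Ico_add' (fun i => theta p (a * q ^ i)) j k M,
    prod_range_mul_prod_Ico _ (by omega)]

lemma qpFactorial_eq_mul_prod_Ico (p q a : ℂ) {j k : ℕ} (hjk : j ≤ k) :
    qpFactorial p q a k = qpFactorial p q a j * ∏ i ∈ Ico j k, theta p (a * q ^ i) :=
  qpFactorial_add_eq_mul_prod_Ico p q a hjk 0

lemma qpFactorial_eq_mul_qpFactorial (p q a : ℂ) {j k : ℕ} (hjk : j ≤ k) :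
    qpFactorial p q a k = qpFactorial p q a j * qpFactorial p q (a * q ^ j) (k - j : ℕ) := by
  rw [qpFactorial_eq_mul_prod_Ico p q a hjk, qpFactorial_natCast p q (a * q ^ j),
    prod_Ico_eq_prod_range]
  simp only [pow_add, mul_assoc]

lemma qpFactorial_succ_left (p q a : ℂ) (k : ℕ) :
    qpFactorial p q a (k + 1 : ℕ) = theta p a * qpFactorial p q (a * q) k := by
  rw [add_comm k 1, qpFactorial_eq_mul_qpFactorial p q a (Nat.le_add_right 1 k),
    qpFactorial_natCast]
  simp

section Bailey

variable {n : ℕ}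

/-- The sum of the components, as a natural number. -/
def natSize (k : Fin n → ℕ) : ℕ := ∑ r, k r

lemma size_eq_natSize (k : Fin n → ℕ) : size k = natSize k := by
  simp [size, natSize]

lemma natSize_mono {j k : Fin n → ℕ} (h : j ≤ k) : natSize j ≤ natSize k :=
  sum_le_sum fun r _ => h r

lemma sum_sub_eq_natSize_sub {j k : Fin n → ℕ} (h : j ≤ k) :
    ∑ r, (k r - j r) = natSize k - natSize j :=
  sum_tsub_distrib _ fun r _ => h r

lemma size_sub_size {j k : Fin n → ℕ} (h : j ≤ k) :
    size k - size j = (natSize k - natSize j : ℕ) := by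
  rw [size_eq_natSize, size_eq_natSize, Nat.cast_sub (natSize_mono h)]

variable {p q : ℂ} {x : Fin n → ℂ}

lemma prod_qpFactorial_eq_bressoudDen (hq : q ≠ 0) {j k : Fin n → ℕ} (h : j ≤ k) :
    (∏ r, ∏ s, qpFactorial p q (q ^ (1 + (j r : ℤ) - (j s : ℤ)) * (x r / x s))
      ((k r : ℤ) - (j r : ℤ))) = bressoudDen p q x j k := by
  refine prod_congr rfl fun r _ => prod_congr rfl fun s _ => ?_
  rw [← Nat.cast_sub (h r), qpFactorial_natCast, prod_Ico_eq_prod_range]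
  refine prod_congr rfl fun i _ => congrArg _ ?_
  rw [mul_comm _ (x r / x s), mul_assoc, ← zpow_natCast q i, ← zpow_add₀ hq]
  congr 2
  push_cast
  ring

lemma bressoudDen_mul {j k N : Fin n → ℕ} (hjk : j ≤ k) (hkN : k ≤ N) :
    bressoudDen p q x j N = bressoudDen p q x j k *
      ∏ r, ∏ s, ∏ i ∈ Ico (k r) (N r), theta p (x r / x s * q ^ ((i : ℤ) + 1 - j s)) := by
  simp only [bressoudDen, ← prod_mul_distrib]
  exact prod_congr rfl fun r _ => prod_congr rfl fun s _ =>
    (prod_Ico_consecutive _ (hjk r) (hkN r)).symm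

lemma bressoudDen_ne_zero {j k : Fin n → ℕ}
    (hΘ : ∀ r s (e : ℤ), (r ≠ s ∨ 0 < e) → theta p (x r / x s * q ^ e) ≠ 0) :
    bressoudDen p q x j k ≠ 0 := by
  refine prod_ne_zero_iff.mpr fun r _ => prod_ne_zero_iff.mpr fun s _ =>
    prod_ne_zero_iff.mpr fun i hi => hΘ r s _ ?_
  rcases eq_or_ne r s with rfl | hrs
  · have := (mem_Ico.mp hi).1
    exact Or.inr (by omega)
  · exact Or.inl hrs

lemma bressoudB1_eq (hq : q ≠ 0) (a b : ℂ) {j k : Fin n → ℕ} (h : j ≤ k) :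
    bressoudB1 p q x a b k j = qpFactorial p q (b / a) (natSize k - natSize j : ℕ) /
      bressoudDen p q x j k * ∏ r, qpFactorial p q (b * x r) (j r + natSize k : ℕ) /
        qpFactorial p q (a * x r * q) (k r + natSize j : ℕ) := by
  rw [bressoudB1, prod_qpFactorial_eq_bressoudDen hq h, size_sub_size h]
  simp only [size_eq_natSize, Nat.cast_add]

/-- Non-vanishing of the theta functions of `x r / x s * q ^ e`, from that of the denominators of
the matrix `B⁽¹⁾`. -/
lemma theta_ratio_ne_zero (hx : ∀ r, x r ≠ 0)
    (hxx : ∀ (r s : Fin n) (j : Fin n → ℕ) (k : ℕ),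
      qpFactorial p q (q ^ (1 + (j r : ℤ) - (j s : ℤ)) * (x r / x s)) k ≠ 0)
    (r s : Fin n) (e : ℤ) (he : r ≠ s ∨ 0 < e) : theta p (x r / x s * q ^ e) ≠ 0 := by
  rcases eq_or_ne r s with rfl | hrs
  · obtain ⟨t, rfl⟩ := Int.eq_succ_of_zero_lt (he.resolve_left (not_not_intro rfl))
    have := hxx r r 0 (t + 1)
    rw [qpFactorial_natCast, prod_range_succ] at this
    convert right_ne_zero_of_mul this using 2
    rw [div_self (hx r), one_mul, mul_one, Pi.zero_apply, Nat.cast_zero, add_zero, sub_zero, zpow_one,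
      ← pow_succ', ← zpow_natCast]
    rfl
  -- The tuple is chosen so that j r - j s = e - 1, whatever the sign of e - 1.
  · have := hxx r s (fun t => if t = r then (e - 1).toNat else (1 - e).toNat) 1
    rw [qpFactorial_natCast, prod_range_one, pow_zero, mul_one, if_pos rfl, if_neg hrs.symm,
      mul_comm] at this
    convert this using 4
    omega

/-- The factors belonging to one index `r` in the product of `β'` with the matrix `B⁽¹⁾`. -/
lemma bailey_factor {a b lam ρ₂ y : ℂ} {j k N J K M : ℕ} (hjk : j ≤ k) (hkN : k ≤ N)
    (hax : ∀ e : ℕ, qpFactorial p q (a * y * q) e ≠ 0)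
    (hbρ₂ : ∀ e : ℕ, qpFactorial p q (b * ρ₂ * y / a) e ≠ 0)
    (hlam : ∀ e : ℕ, qpFactorial p q (lam * y) e ≠ 0) (Y : ℂ) :
    qpFactorial p q (b * ρ₂ * y / a) N / Y *
      (qpFactorial p q (ρ₂ * y) k / qpFactorial p q (b * ρ₂ * y / a) k) *
      (theta p (lam * y * q ^ (k + K)) / theta p (lam * y) *
        (qpFactorial p q (b * y) (k + M : ℕ) / qpFactorial p q (lam * y * q) (K + N : ℕ))) *
      (qpFactorial p q (lam * y) (j + K : ℕ) / qpFactorial p q (a * y * q) (k + J : ℕ)) =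
    qpFactorial p q (ρ₂ * y) j * qpFactorial p q (b * y) (j + M : ℕ) /
        (Y * qpFactorial p q (a * y * q) (N + J : ℕ)) *
      (∏ i ∈ Ico j k, theta p (ρ₂ * y * q ^ i) * theta p (b * q ^ M * y * q ^ i) /
        theta p (lam * q ^ K * y * q ^ i)) *
      ∏ i ∈ Ico k N, theta p (b * ρ₂ / a * y * q ^ i) * theta p (a * q * q ^ J * y * q ^ i) /
        theta p (lam * q ^ (K + 1) * y * q ^ i) := by
  have E : ∀ c d M i, c * q ^ M * d * q ^ i = c * d * q ^ (i + M) := fun c d M i => by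
    rw [pow_add]; ring
  have h1 := qpFactorial_eq_mul_prod_Ico p q (b * ρ₂ * y / a) hkN
  have h2 := qpFactorial_eq_mul_prod_Ico p q (ρ₂ * y) hjk
  have h3 := qpFactorial_add_eq_mul_prod_Ico p q (b * y) hjk M
  have h4 := qpFactorial_add_eq_mul_prod_Ico p q (a * y * q) hkN J
  -- Both sides are (λy)_(K+N+1), split at j + K and k + K; the single factor in between is the
  -- numerator θ(λ y q^(k+K)) of β'.
  have h5 : theta p (lam * y) * qpFactorial p q (lam * y * q) (K + N : ℕ) =
      qpFactorial p q (lam * y) (j + K : ℕ) *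
        ((∏ i ∈ Ico j k, theta p (lam * y * q ^ (i + K))) * (theta p (lam * y * q ^ (k + K)) *
          ∏ i ∈ Ico k N, theta p (lam * y * q ^ (i + (K + 1))))) := by
    rw [← qpFactorial_succ_left, show K + N + 1 = (N + 1) + K by ring,
      qpFactorial_add_eq_mul_prod_Ico p q (lam * y) (show j ≤ N + 1 by omega) K,
      ← prod_Ico_consecutive _ hjk (show k ≤ N + 1 by omega),
      prod_eq_prod_Ico_succ_bot (show k < N + 1 by omega),
      ← prod_Ico_add' (fun i => theta p (lam * y * q ^ (i + K))) k N 1]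
    simp only [add_assoc, add_comm 1 K]
  have n5 : theta p (lam * y) * qpFactorial p q (lam * y * q) (K + N : ℕ) ≠ 0 := by
    rw [← qpFactorial_succ_left]; exact hlam _
  have n1 := hbρ₂ k
  have n4 := hax (N + J)
  rw [h4] at n4
  rw [h5] at n5
  have e1 : b * ρ₂ / a * y = b * ρ₂ * y / a := by ring
  have e2 : ∀ i, a * q * q ^ J * y * q ^ i = a * y * q * q ^ (i + J) := fun i => by
    rw [pow_add]; ring
  simp only [prod_div_distrib, prod_mul_distrib, E b, E lam, e1, e2]
  rw [h1, h2, h3, h4, div_mul_div_comm (theta p (lam * y * q ^ (k + K))), h5]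
  simp only [mul_ne_zero_iff] at n4 n5
  obtain ⟨n6, n7⟩ := n4
  obtain ⟨n8, n9, n10, n11⟩ := n5
  generalize ∏ i ∈ Ico j k, theta p (lam * y * q ^ (i + K)) = P₁ at *
  generalize ∏ i ∈ Ico k N, theta p (lam * y * q ^ (i + (K + 1))) = P₂ at *
  generalize ∏ i ∈ Ico k N, theta p (a * y * q * q ^ (i + J)) = P₃ at *
  generalize ∏ i ∈ Ico k N, theta p (b * ρ₂ * y / a * q ^ i) = P₄ at *
  generalize ∏ i ∈ Ico j k, theta p (ρ₂ * y * q ^ i) = P₅ at *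
  generalize ∏ i ∈ Ico j k, theta p (b * y * q ^ (i + M)) = P₆ at *
  generalize theta p (lam * y * q ^ (k + K)) = P₇ at *
  generalize qpFactorial p q (lam * y) (j + K : ℕ) = P₈ at *
  generalize qpFactorial p q (a * y * q) (k + J : ℕ) = P₉ at *
  generalize qpFactorial p q (b * ρ₂ * y / a) k = P₁₀ at *
  field_simp

end Bailey

/-! ### The kernel of the lemma applied to the matrix -/

section Kernel

variable {n : ℕ}

/-- The coefficient of `α_N` in `α'_N`. -/
def alphaWeight (p q : ℂ) (x : Fin n → ℂ) (ρ₁ ρ₂ a : ℂ) (N : Fin n → ℕ) : ℂ :=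
  qpFactorial p q ρ₁ (size N) / qpFactorial p q (a * q / ρ₂) (size N) *
    (∏ r, qpFactorial p q (ρ₂ * x r) (N r) / qpFactorial p q (a * x r * q / ρ₁) (N r)) *
    (a * q / (ρ₁ * ρ₂)) ^ size N

/-- The coefficient of `β_k` in `β'_N`. -/
def betaKernel (p q : ℂ) (x : Fin n → ℂ) (ρ₁ ρ₂ a b : ℂ) (N k : Fin n → ℕ) : ℂ :=
  qpFactorial p q (b * ρ₁ / a) (size N) / qpFactorial p q (a * q / ρ₂) (size N) *
    (∏ r, qpFactorial p q (b * ρ₂ * x r / a) (N r) /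
      qpFactorial p q (a * x r * q / ρ₁) (N r)) *
    (qpFactorial p q ρ₁ (size k) / qpFactorial p q (b * ρ₁ / a) (size k) *
      (∏ r, qpFactorial p q (ρ₂ * x r) (k r) / qpFactorial p q (b * ρ₂ * x r / a) (k r)) *
      (∏ r, theta p (b * ρ₁ * ρ₂ * x r * q ^ ((k r : ℤ) + size k) / (a * q)) /
          theta p (b * ρ₁ * ρ₂ * x r / (a * q)) *
        (qpFactorial p q (b * x r) ((k r : ℤ) + size N) /
          qpFactorial p q (b * ρ₁ * ρ₂ * x r / a) (size k + (N r : ℤ)))) *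
      (qpFactorial p q (a * q / (ρ₁ * ρ₂)) (size N - size k) /
        ∏ r, ∏ s, qpFactorial p q (q ^ (1 + (k r : ℤ) - (k s : ℤ)) * (x r / x s))
          ((N r : ℤ) - (k r : ℤ))) *
      (a * q / (ρ₁ * ρ₂)) ^ size k)

lemma betaPrime_eq_sum (p q : ℂ) (x : Fin n → ℂ) (ρ₁ ρ₂ : ℂ) (β : ℂ → ℂ → (Fin n → ℕ) → ℂ)
    (a b : ℂ) (N : Fin n → ℕ) :
    betaPrime p q x ρ₁ ρ₂ β a b N = ∑ k ∈ Icc 0 N, betaKernel p q x ρ₁ ρ₂ a b N k *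
      β a (b * ρ₁ * ρ₂ / (a * q)) k := by
  rw [betaPrime, mul_sum]
  exact sum_congr rfl fun k _ => (mul_assoc _ _ _).symm

variable {p q : ℂ} {x : Fin n → ℂ} {a b ρ₁ ρ₂ : ℂ}

lemma betaKernel_eq (hq : q ≠ 0) (ha : a ≠ 0) {N k : Fin n → ℕ} (hkN : k ≤ N) :
    betaKernel p q x ρ₁ ρ₂ a b N k =
    qpFactorial p q (b * ρ₁ / a) (natSize N) / qpFactorial p q (a * q / ρ₂) (natSize N) *
    (∏ r, qpFactorial p q (b * ρ₂ * x r / a) (N r) /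
      qpFactorial p q (a * x r * q / ρ₁) (N r)) *
    (qpFactorial p q ρ₁ (natSize k) / qpFactorial p q (b * ρ₁ / a) (natSize k) *
      (∏ r, qpFactorial p q (ρ₂ * x r) (k r) / qpFactorial p q (b * ρ₂ * x r / a) (k r)) *
      (∏ r, theta p (b * ρ₁ * ρ₂ / (a * q) * x r * q ^ (k r + natSize k)) /
          theta p (b * ρ₁ * ρ₂ / (a * q) * x r) *
        (qpFactorial p q (b * x r) (k r + natSize N : ℕ) /
          qpFactorial p q (b * ρ₁ * ρ₂ / (a * q) * x r * q) (natSize k + N r : ℕ))) *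
      (qpFactorial p q (a * q / (ρ₁ * ρ₂)) (natSize N - natSize k : ℕ) / bressoudDen p q x k N) *
      (a * q / (ρ₁ * ρ₂)) ^ natSize k) := by
  rw [betaKernel, prod_qpFactorial_eq_bressoudDen hq hkN, size_sub_size hkN]
  have e1 : ∀ r, b * ρ₁ * ρ₂ * x r / (a * q) = b * ρ₁ * ρ₂ / (a * q) * x r := fun r => by ring
  have e2 : ∀ r, b * ρ₁ * ρ₂ * x r / a = b * ρ₁ * ρ₂ / (a * q) * x r * q := fun r => by
    field_simp
  have e3 : ∀ r (e : ℕ), b * ρ₁ * ρ₂ * x r * q ^ e / (a * q) =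
      b * ρ₁ * ρ₂ / (a * q) * x r * q ^ e := fun r e => by ring
  simp only [size_eq_natSize, ← Nat.cast_add, zpow_natCast, e1, e2, e3]

/-- Separates the factors free of k from the summand of the Jackson sum, treating each product as an
atom. The hypothesis `h` is `bailey_factor` multiplied over r. -/
lemma kernel_regroup {R₁ R₁' S P₁ R₂ B P₂ P₃ G W F₁ F₂ C W' P₄ P₀ S₁ S₂ V : ℂ} (hR : R₁ ≠ 0)
    (hV : V ≠ 0) (h : P₁ * P₂ * P₃ * P₄ = P₀ * S₁ * S₂) :
    R₁ * R₁' / S * P₁ * (R₂ * B / R₁ * P₂ * P₃ * (G / W) * (F₁ * F₂)) * (C / W' * P₄) =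
      R₂ / S * P₀ * F₁ / (W' * V) * (F₂ * (V / W * S₁ * S₂ * (B * C * R₁' * G))) := by
  have e1 : R₁ * R₁' / S * P₁ * (R₂ * B / R₁ * P₂ * P₃ * (G / W) * (F₁ * F₂)) * (C / W' * P₄) =
      R₁ / R₁ * (R₁' / S * (R₂ * B * (G / W) * (F₁ * F₂)) * (C / W') * (P₁ * P₂ * P₃ * P₄)) := by
    ring
  have e2 : R₂ / S * P₀ * F₁ / (W' * V) * (F₂ * (V / W * S₁ * S₂ * (B * C * R₁' * G))) =
      V / V * (R₁' / S * (R₂ * B * (G / W) * (F₁ * F₂)) * (C / W') * (P₀ * S₁ * S₂)) := by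
    ring
  rw [e1, e2, h, div_self hR, div_self hV]

/-- The product of `β'` with the matrix `B⁽¹⁾`, term by term. -/
lemma betaKernel_mul_bressoudB1 (hq : q ≠ 0) (ha : a ≠ 0)
    (hΘ : ∀ r s (e : ℤ), (r ≠ s ∨ 0 < e) → theta p (x r / x s * q ^ e) ≠ 0)
    (hax : ∀ (r : Fin n) (k : ℕ), qpFactorial p q (a * x r * q) k ≠ 0)
    (hbρ₁ : ∀ k : ℕ, qpFactorial p q (b * ρ₁ / a) k ≠ 0)
    (hbρ₂ : ∀ (r : Fin n) (k : ℕ), qpFactorial p q (b * ρ₂ * x r / a) k ≠ 0)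
    (hlam : ∀ (r : Fin n) (k : ℕ), qpFactorial p q (b * ρ₁ * ρ₂ / (a * q) * x r) k ≠ 0)
    {j k N : Fin n → ℕ} (hjk : j ≤ k) (hkN : k ≤ N) :
    betaKernel p q x ρ₁ ρ₂ a b N k * bressoudB1 p q x a (b * ρ₁ * ρ₂ / (a * q)) k j =
    (qpFactorial p q ρ₁ (natSize j) / qpFactorial p q (a * q / ρ₂) (natSize N) *
      (∏ r, qpFactorial p q (ρ₂ * x r) (j r) * qpFactorial p q (b * x r) (j r + natSize N : ℕ) /
        (qpFactorial p q (a * x r * q / ρ₁) (N r) *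
          qpFactorial p q (a * x r * q) (N r + natSize j : ℕ))) *
      (a * q / (ρ₁ * ρ₂)) ^ natSize j / bressoudDen p q x j N) *
    ((a * q / (ρ₁ * ρ₂)) ^ (natSize k - natSize j) *
      ((∏ r, ∏ s, ∏ i ∈ Ico (k r) (N r), theta p (x r / x s * q ^ ((i : ℤ) + 1 - j s))) /
        bressoudDen p q x k N *
      stringRatio p q x j k ρ₂ (b * q ^ natSize N) (b * ρ₁ * ρ₂ / (a * q) * q ^ natSize k) *
      stringRatio p q x k N (b * ρ₂ / a) (a * q * q ^ natSize j)
        (b * ρ₁ * ρ₂ / (a * q) * q ^ (natSize k + 1)) *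
      (qpFactorial p q (ρ₁ * q ^ natSize j) (natSize k - natSize j : ℕ) *
        qpFactorial p q (b * ρ₁ * ρ₂ / (a * q) / a) (natSize k - natSize j : ℕ) *
        qpFactorial p q (b * ρ₁ / a * q ^ natSize k) (natSize N - natSize k : ℕ) *
        qpFactorial p q (a * q / (ρ₁ * ρ₂)) (natSize N - natSize k : ℕ)))) := by
  have hJK := natSize_mono hjk
  have hKM := natSize_mono hkN
  rw [betaKernel_eq hq ha hkN, bressoudB1_eq hq _ _ hjk]
  set lam := b * ρ₁ * ρ₂ / (a * q)
  have hprod := prod_congr (rfl : (univ : Finset (Fin n)) = univ) fun r _ =>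
    bailey_factor (b := b) (J := natSize j) (K := natSize k) (M := natSize N) (hjk r) (hkN r) (hax r)
      (hbρ₂ r) (hlam r) (qpFactorial p q (a * x r * q / ρ₁) (N r))
  simp only [prod_mul_distrib] at hprod ⊢
  have hden := bressoudDen_ne_zero (j := j) (k := N) hΘ
  rw [bressoudDen_mul hjk hkN] at hden ⊢
  rw [qpFactorial_eq_mul_qpFactorial p q (b * ρ₁ / a) hKM,
    qpFactorial_eq_mul_qpFactorial p q ρ₁ hJK,
    ← pow_mul_pow_sub (a * q / (ρ₁ * ρ₂)) hJK]
  exact kernel_regroup (hbρ₁ _) (right_ne_zero_of_mul hden) hprod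

/-- The product of `β'` with the matrix `B⁽¹⁾`. -/
lemma sum_betaKernel_mul_bressoudB1 (hp : ‖p‖ < 1) (hq : q ≠ 0) (hx : ∀ r, x r ≠ 0)
    (ha : a ≠ 0) (hb : b ≠ 0) (hρ₁ : ρ₁ ≠ 0) (hρ₂ : ρ₂ ≠ 0)
    (hΘ : ∀ r s (e : ℤ), (r ≠ s ∨ 0 < e) → theta p (x r / x s * q ^ e) ≠ 0)
    (hax : ∀ (r : Fin n) (k : ℕ), qpFactorial p q (a * x r * q) k ≠ 0)
    (haρ₁ : ∀ (r : Fin n) (k : ℕ), qpFactorial p q (a * x r * q / ρ₁) k ≠ 0)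
    (haρ₂ : ∀ k : ℕ, qpFactorial p q (a * q / ρ₂) k ≠ 0)
    (hbρ₁ : ∀ k : ℕ, qpFactorial p q (b * ρ₁ / a) k ≠ 0)
    (hbρ₂ : ∀ (r : Fin n) (k : ℕ), qpFactorial p q (b * ρ₂ * x r / a) k ≠ 0)
    (hlam : ∀ (r : Fin n) (k : ℕ), qpFactorial p q (b * ρ₁ * ρ₂ / (a * q) * x r) k ≠ 0)
    {j N : Fin n → ℕ} (hjN : j ≤ N) :
    ∑ k ∈ Icc j N, betaKernel p q x ρ₁ ρ₂ a b N k *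
      bressoudB1 p q x a (b * ρ₁ * ρ₂ / (a * q)) k j =
    bressoudB1 p q x a b N j * alphaWeight p q x ρ₁ ρ₂ a j := by
  have hJM := natSize_mono hjN
  have hlam0 : b * ρ₁ * ρ₂ / (a * q) ≠ 0 := by positivity
  rw [sum_congr rfl fun k hk => betaKernel_mul_bressoudB1 hq ha hΘ hax hbρ₁ hbρ₂ hlam
    (mem_Icc.mp hk).1 (mem_Icc.mp hk).2, ← mul_sum]
  -- Matching the summand of `betaKernel_mul_bressoudB1` dictates the parameters. The balancing
  -- condition Aq = BCDF holds because λ/a · ρ₁ρ₂ · aq/(ρ₁ρ₂) = λq.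
  have main := sum_Icc_theta (x := x) hp hq hx hjN (A := b * ρ₁ * ρ₂ / (a * q) * q ^ natSize j)
    (B := ρ₁ * q ^ natSize j) (C := b * ρ₁ * ρ₂ / (a * q) / a) (D := ρ₂) (F := a * q / (ρ₁ * ρ₂))
    (by positivity) (by positivity) hρ₂ (by positivity) (by field_simp) hΘ (fun r e => ?_)
    (sum_sub_eq_natSize_sub hjN).symm
  · have e1 : b * ρ₁ * ρ₂ / (a * q) * q ^ natSize j * (a * q / (ρ₁ * ρ₂)) *
        q ^ (natSize N - natSize j) = b * q ^ natSize N := by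
      rw [← pow_mul_pow_sub q hJM]; field_simp
    have e2 : ∀ k, j ≤ k → b * ρ₁ * ρ₂ / (a * q) * q ^ natSize j * q ^ (natSize k - natSize j) =
        b * ρ₁ * ρ₂ / (a * q) * q ^ natSize k := fun k hk => by
      rw [mul_assoc, pow_mul_pow_sub q (natSize_mono hk)]
    have e3 : ∀ k, j ≤ k → b * ρ₁ * ρ₂ / (a * q) * q ^ natSize j *
        q ^ (natSize k - natSize j + 1) = b * ρ₁ * ρ₂ / (a * q) * q ^ (natSize k + 1) :=
      fun k hk => by rw [pow_succ, pow_succ, ← mul_assoc, e2 k hk, mul_assoc]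
    have e4 : b * ρ₁ * ρ₂ / (a * q) / a * ρ₂ * (a * q / (ρ₁ * ρ₂)) = b * ρ₂ / a := by
      field_simp
    have e5 : ρ₁ * q ^ natSize j * ρ₂ * (a * q / (ρ₁ * ρ₂)) = a * q * q ^ natSize j := by
      field_simp
    have e6 : ∀ k, j ≤ k → ρ₁ * q ^ natSize j * (b * ρ₁ * ρ₂ / (a * q) / a) *
        (a * q / (ρ₁ * ρ₂)) * q ^ (natSize k - natSize j) = b * ρ₁ / a * q ^ natSize k :=
      fun k hk => by rw [← pow_mul_pow_sub q (natSize_mono hk)]; field_simp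
    have e7 : ∀ k, j ≤ k → natSize N - natSize j - (natSize k - natSize j) =
        natSize N - natSize k := fun k hk => by
      have := natSize_mono hk
      omega
    have e8 : ρ₁ * q ^ natSize j * (a * q / (ρ₁ * ρ₂)) = a * q / ρ₂ * q ^ natSize j := by
      field_simp
    have e9 : b * ρ₁ * ρ₂ / (a * q) / a * (a * q / (ρ₁ * ρ₂)) = b / a := by
      field_simp
    have e10 : ∀ r, ρ₂ * (a * q / (ρ₁ * ρ₂)) * x r = a * x r * q / ρ₁ := fun r => by
      field_simp
    have hsum := main.symm.trans (sum_congr rfl fun k hk => by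
      have hjk := (mem_Icc.mp hk).1
      rw [sum_sub_eq_natSize_sub hjk, e1, e2 k hjk, e3 k hjk, e4, e5, e6 k hjk, e7 k hjk])
    rw [← hsum, e8, e9, bressoudB1_eq hq a b hjN, alphaWeight, size_eq_natSize, zpow_natCast,
      qpFactorial_eq_mul_qpFactorial p q (a * q / ρ₂) hJM]
    have hS : qpFactorial p q (a * q / ρ₂) (natSize j) *
        qpFactorial p q (a * q / ρ₂ * q ^ natSize j) (natSize N - natSize j : ℕ) ≠ 0 := by
      rw [← qpFactorial_eq_mul_qpFactorial p q (a * q / ρ₂) hJM]; exact haρ₂ _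
    have hprod : (∏ r, qpFactorial p q (ρ₂ * x r) (j r) *
        qpFactorial p q (b * x r) (j r + natSize N : ℕ) /
        (qpFactorial p q (a * x r * q / ρ₁) (N r) *
          qpFactorial p q (a * x r * q) (N r + natSize j : ℕ))) *
        ∏ r, ∏ i ∈ Ico (j r) (N r), theta p (ρ₂ * (a * q / (ρ₁ * ρ₂)) * x r * q ^ i) =
        (∏ r, qpFactorial p q (b * x r) (j r + natSize N : ℕ) /
          qpFactorial p q (a * x r * q) (N r + natSize j : ℕ)) *
        ∏ r, qpFactorial p q (ρ₂ * x r) (j r) / qpFactorial p q (a * x r * q / ρ₁) (j r) := by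
      simp only [e10, ← prod_mul_distrib]
      refine prod_congr rfl fun r _ => ?_
      have h1 := qpFactorial_eq_mul_prod_Ico p q (a * x r * q / ρ₁) (hjN r)
      have h2 := haρ₁ r (N r)
      rw [h1] at h2 ⊢
      obtain ⟨h3, h4⟩ := mul_ne_zero_iff.mp h2
      generalize ∏ i ∈ Ico (j r) (N r), theta p (a * x r * q / ρ₁ * q ^ i) = P₁ at *
      generalize qpFactorial p q (a * x r * q / ρ₁) (j r) = P₂ at *
      generalize qpFactorial p q (a * x r * q) (N r + natSize j : ℕ) = P₃
      field_simp
    have alg : ∀ R S S' P₀ F W B P₁ P₂ P₃ : ℂ, S * S' ≠ 0 → P₀ * P₁ = P₂ * P₃ →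
        R / (S * S') * P₀ * F / W * (S' * B * P₁) = B / W * P₂ * (R / S * P₃ * F) := by
      intro R S S' P₀ F W B P₁ P₂ P₃ hS h
      obtain ⟨h1, h2⟩ := mul_ne_zero_iff.mp hS
      calc _ = R / S * F / W * B * (P₀ * P₁) := by field_simp
        _ = _ := by rw [h]; ring
    exact alg _ _ _ _ _ _ _ _ _ _ hS hprod
  · have := hlam r (natSize j + (j r + (e + 1)) + 1)
    rw [qpFactorial_natCast, prod_range_succ] at this
    convert right_ne_zero_of_mul this using 2
    rw [pow_add]
    ring

end Kernel

end EllipticWPBailey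

end

/-! ### The WP Bailey lemma -/

open EllipticWPBailey in
theorem mainTheorem7 {n : ℕ} (p q : ℂ) (hp : ‖p‖ < 1) (hq : q ≠ 0)
    (x : Fin n → ℂ) (hx : ∀ r, x r ≠ 0)
    (a b ρ₁ ρ₂ : ℂ) (ha : a ≠ 0) (hb : b ≠ 0) (hρ₁ : ρ₁ ≠ 0) (hρ₂ : ρ₂ ≠ 0)
    -- no denominator in the matrix `B⁽¹⁾`, in `α'` or in `β'` vanishes
    (hxx : ∀ (r s : Fin n) (j : Fin n → ℕ) (k : ℕ),
      EllipticWPBailey.qpFactorial p q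
        (q ^ (1 + (j r : ℤ) - (j s : ℤ)) * (x r / x s)) k ≠ 0)
    (hax : ∀ (r : Fin n) (k : ℕ), EllipticWPBailey.qpFactorial p q (a * x r * q) k ≠ 0)
    (haρ₁ : ∀ (r : Fin n) (k : ℕ), EllipticWPBailey.qpFactorial p q (a * x r * q / ρ₁) k ≠ 0)
    (haρ₂ : ∀ k : ℕ, EllipticWPBailey.qpFactorial p q (a * q / ρ₂) k ≠ 0)
    (hbρ₁ : ∀ k : ℕ, EllipticWPBailey.qpFactorial p q (b * ρ₁ / a) k ≠ 0)
    (hbρ₂ : ∀ (r : Fin n) (k : ℕ), EllipticWPBailey.qpFactorial p q (b * ρ₂ * x r / a) k ≠ 0)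
    (hθ : ∀ r : Fin n, EllipticWPBailey.theta p (b * ρ₁ * ρ₂ * x r / (a * q)) ≠ 0)
    (hbρ : ∀ (r : Fin n) (k : ℕ),
      EllipticWPBailey.qpFactorial p q (b * ρ₁ * ρ₂ * x r / a) k ≠ 0)
    (α β : ℂ → ℂ → (Fin n → ℕ) → ℂ)
    (hpair : EllipticWPBailey.IsWPBaileyPair (EllipticWPBailey.bressoudB1 p q x) α β
      a (b * ρ₁ * ρ₂ / (a * q))) :
    EllipticWPBailey.IsWPBaileyPair (EllipticWPBailey.bressoudB1 p q x)
      (EllipticWPBailey.alphaPrime p q x ρ₁ ρ₂ α)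
      (EllipticWPBailey.betaPrime p q x ρ₁ ρ₂ β) a b := by
  intro N
  -- (λx_r)_(k+1) = θ(λx_r) (λx_r q)_k, so the hypotheses on θ(λx_r) and on (bρ₁ρ₂x_r/a)_k together
  -- cover the denominators.
  have hlam : ∀ (r : Fin n) (k : ℕ), qpFactorial p q (b * ρ₁ * ρ₂ / (a * q) * x r) k ≠ 0 := by
    intro r k
    have e1 : b * ρ₁ * ρ₂ / (a * q) * x r = b * ρ₁ * ρ₂ * x r / (a * q) := by ring
    have e2 : b * ρ₁ * ρ₂ / (a * q) * x r * q = b * ρ₁ * ρ₂ * x r / a := by field_simp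
    rcases k with _ | k
    · rw [qpFactorial_natCast]; simp
    · rw [qpFactorial_succ_left, e2, e1]
      exact mul_ne_zero (hθ r) (hbρ r k)
  -- Both descriptions say 0 ≤ j ≤ k ≤ N; the sum over k becomes the inner one, to be evaluated by
  -- the kernel identity.
  have hswap : ∀ k j : Fin n → ℕ, k ∈ Finset.Icc 0 N ∧ j ∈ Finset.Icc 0 k ↔
      k ∈ Finset.Icc j N ∧ j ∈ Finset.Icc 0 N := by
    intro k j
    simp only [Finset.mem_Icc]
    exact ⟨fun h => ⟨⟨h.2.2, h.1.2⟩, h.2.1, h.2.2.trans h.1.2⟩,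
      fun h => ⟨⟨h.2.1.trans h.1.1, h.1.2⟩, h.2.1, h.1.1⟩⟩
  rw [betaPrime_eq_sum, Finset.sum_congr rfl fun k _ => by rw [hpair k, Finset.mul_sum],
    Finset.sum_comm' hswap]
  refine Finset.sum_congr rfl fun j hj => ?_
  have h := sum_betaKernel_mul_bressoudB1 hp hq hx ha hb hρ₁ hρ₂ (theta_ratio_ne_zero hx hxx)
    hax haρ₁ haρ₂ hbρ₁ hbρ₂ hlam (Finset.mem_Icc.mp hj).2
  simp only [← mul_assoc]
  rw [← Finset.sum_mul, h, mul_assoc]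
  rfl
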